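/- **Setting.** Let $M$ be a (Hausdorff, second countable) $C^1$ manifold of dimension $m$, $f:M\to M$ a $C^1$ map, $\mu$ an $f$-ergodic Borel probability measure with compact support $\Omega$, and $\varphi:M\to\mathbb R^d$ a $C^1$ measurement. Let $\Phi:\Omega\to\mathbb R^L$ be injective with $\Phi\circ f=g\circ(\varphi,\Phi)$ on $\Omega$ for some $g:\mathbb R^d\times\mathbb R^L\to\mathbb R^L$, and for $n\in\mathbb N=\{0,1,2,\dots\}$ let $w_n:\mathbb R^L\to\mathbb R^d$ satisfy $w_n\circ\Phi=\varphi\circ f^n$ on $\Omega$. Let $U\psi=\psi\circ f$ be the Koopman operator on $L^2(\mu)$, and let $\mathcal D$ be the closed linear span in complex $L^2(\mu)$ of the eigenfunctions of $U$ (for vector-valued functions: componentwise). The map $f$ is *weakly mixing* if $\mathcal D$ consists of the constants only, *strongly mixing* if $\mu(A\cap f^{-n}B)\to\mu(A)\mu(B)$ for all measurable $A,B$, and has *purely discrete spectrum* if $\mathcal D=L^2(\mu)$. Fix $\mathbb K\in\{\mathbb R,\mathbb C\}$. Let $\mathcal H$ be a linear space of functions $h:\mathbb R^L\to\mathbb K^d$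 with $h\circ\Phi\in L^2(\mu;\mathbb K^d)$, let $\mathcal W=\mathcal W(\mathcal H)=\{h\circ\Phi: h\in\mathcal H\}\subseteq L^2(\mu;\mathbb K^d)$, and let $\pi=\pi_{\mathcal W}$ be the orthogonal projection onto $\mathcal W$ (onto its closure, if $\mathcal W$ is not closed). Let $\hat w_n\in\mathcal H$ be a closest approximation of $w_n$, that is, $\hat w_n$ minimizes $\|w_n\circ\Phi-h\circ\Phi\|_{L^2(\mu)}$ over $h\in\mathcal H$, and put $\mathrm{error}_{\mathrm{direct}}(n)=\|U^n\varphi-\hat w_n\circ\Phi\|_{L^2(\mu)}$. **Theorem 5.1 (error from direct forecast).** Whenever a closest approximation $\hat w_n$ exists, $$\mathrm{error}_{\mathrm{direct}}(n)=\|(\mathrm{Id}-\pi)U^n\varphi\|_{L^2(\mu)} .$$ Call $\mathcal H$ (or $\mathcal W$) a *hypothesis space* if $\mathcal W$ is finite-dimensional and contains the constant functions; then closest approximations exist for all $n$. There is a set $\mathbb N'\subseteq\mathbb N$ of natural density $1$, not depending on the hypothesis space, such that the following holds. Put $c=\|\varphi-\mathrm{proj}_{\mathcal D}\varphi\|_{L^2(\mu)}$.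 1. For every hypothesis space $\mathcal W$, $\liminf_{n\in\mathbb N',\,n\to\infty}\mathrm{error}_{\mathrm{direct}}(n)\ge c$. For every $\epsilon>0$ there is a hypothesis space $\mathcal W_0$ for which $\lim_{n\in\mathbb N',\,n\to\infty}\mathrm{error}_{\mathrm{direct}}(n)$ exists and lies in $[c,c+\epsilon)$, and such that for every hypothesis space $\mathcal W\supseteq\mathcal W_0$ one has $\mathrm{error}_{\mathrm{direct}}(n)<c+\epsilon$ for all sufficiently large $n\in\mathbb N'$. 2. If $f$ is weakly mixing, then for every hypothesis space $\lim_{n\in\mathbb N',\,n\to\infty}\mathrm{error}_{\mathrm{direct}}(n)=\|\varphi-\mu(\varphi)\|_{L^2(\mu)}$, where $\mu(\varphi)=\int\varphi\,d\mu$. 3. If $f$ is strongly mixing, then $\mathbb N'$ can be taken to be $\mathbb N$; in particular, for every hypothesis space $\lim_{n\to\infty}\mathrm{error}_{\mathrm{direct}}(n)=\|\varphi-\mu(\varphi)\|_{L^2(\mu)}$. 4. If $f$ has purely discrete spectrum, then for every $\epsilon>0$ there is a hypothesis space $\mathcal W_0$ such that for every hypothesis space $\mathcal W\supseteq\mathcal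 W_0$ one has $\mathrm{error}_{\mathrm{direct}}(n)<\epsilon$ for all $n\in\mathbb N$. -/

import Mathlib

open MeasureTheory Filter Topology
open scoped ENNReal Manifold

namespace DirectForecast

/-- A set of natural numbers has (natural) density one: `|A ∩ {0, …, N-1}| / N → 1`. -/
def HasDensityOne (A : Set ℕ) : Prop :=
  Tendsto (fun N : ℕ => ((A ∩ Set.Iio N).ncard : ℝ) / (N : ℝ)) atTop (𝓝 1)

/-- A measure on a second countable space with compact support makes every continuous function
square integrable. -/
theorem memLp_of_isCompact_support {M E : Type*} [TopologicalSpace M] [SecondCountableTopology M]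
    [MeasurableSpace M] [BorelSpace M] [NormedAddCommGroup E] [SecondCountableTopology E]
    {μ : Measure M} [IsProbabilityMeasure μ]
    (hμ : IsCompact μ.support) {ψ : M → E} (hψ : Continuous ψ) : MemLp ψ 2 μ := by
  borelize E
  obtain ⟨C, hC⟩ := hμ.exists_bound_of_continuousOn hψ.continuousOn
  refine MemLp.of_bound hψ.stronglyMeasurable.aestronglyMeasurable C ?_
  filter_upwards [Measure.support_mem_ae (μ := μ)] with x hx using hC x hx

/-- The coordinatewise inclusion `ℝ^d → 𝕜^d`, for `𝕜 = ℝ` (the identity) or `𝕜 = ℂ`. -/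
def ofRealVec (𝕜 : Type*) [RCLike 𝕜] {d : ℕ} (v : EuclideanSpace ℝ (Fin d)) :
    EuclideanSpace 𝕜 (Fin d) :=
  WithLp.toLp 2 fun i => ((v i : ℝ) : 𝕜)

theorem continuous_ofRealVec (𝕜 : Type*) [RCLike 𝕜] {d : ℕ} :
    Continuous (ofRealVec 𝕜 (d := d)) := by
  unfold ofRealVec
  refine (PiLp.continuous_toLp 2 _).comp (continuous_pi fun i => ?_)
  exact RCLike.continuous_ofReal.comp (PiLp.continuous_apply 2 _ i)

section Koopman

variable {M : Type*} [MeasurableSpace M] {μ : Measure M} {f : M → M}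

/-- The Koopman operator `U ψ = ψ ∘ f` on the space of square integrable `E`-valued functions,
for a measure preserving map `f`. -/
noncomputable def koopman (𝕜 E : Type*) [RCLike 𝕜] [NormedAddCommGroup E] [NormedSpace 𝕜 E]
    (hf : MeasurePreserving f μ μ) : Lp E 2 μ →ₗ[𝕜] Lp E 2 μ :=
  (Lp.compMeasurePreservingₗᵢ 𝕜 f hf).toLinearMap

/-- The space `𝒟`: the closed linear span of the eigenfunctions of the Koopman operator on the
complex Hilbert space `L²(μ; E)`. For `E = ℂ^d` it consists of the functions all of whose
components lie in the space `𝒟` of scalar functions. -/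
noncomputable abbrev discreteSubspace (E : Type*) [NormedAddCommGroup E] [NormedSpace ℂ E]
    (hf : MeasurePreserving f μ μ) : Submodule ℂ (Lp E 2 μ) :=
  (Submodule.span ℂ {ψ : Lp E 2 μ |
    ∃ c : ℂ, Module.End.HasEigenvector (koopman ℂ E hf) c ψ}).topologicalClosure

/-- Weak mixing: the only eigenfunctions are the constants, `𝒟 = ℂ · 1`. -/
def IsWeaklyMixing [IsFiniteMeasure μ] (hf : MeasurePreserving f μ μ) : Prop :=
  discreteSubspace ℂ hf = Submodule.span ℂ {Lp.const 2 μ (1 : ℂ)}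

/-- Strong mixing: `μ(A ∩ f⁻ⁿ B) → μ(A) μ(B)` for all measurable `A`, `B`. -/
def IsStronglyMixing (μ : Measure M) (f : M → M) : Prop :=
  ∀ A B : Set M, MeasurableSet A → MeasurableSet B →
    Tendsto (fun n : ℕ => μ (A ∩ f^[n] ⁻¹' B)) atTop (𝓝 (μ A * μ B))

/-- Purely discrete spectrum: the eigenfunctions span a dense subspace, `𝒟 = L²(μ)`. -/
def HasPurelyDiscreteSpectrum (hf : MeasurePreserving f μ μ) : Prop :=
  discreteSubspace ℂ hf = ⊤

end Koopman

section Hypothesis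

variable {M : Type*} [MeasurableSpace M] {𝕜 : Type*} [RCLike 𝕜] {d L : ℕ}

/-- The subspace `𝒲 = {h ∘ Φ : h ∈ H}` of `L²(μ; 𝕜^d)` associated with a linear space `H` of
functions `ℝ^L → 𝕜^d` and the map `Φ` (elements of `L²` are classes modulo null sets). -/
def hypSubspace (μ : Measure M) (Φ : M → EuclideanSpace ℝ (Fin L))
    (H : Submodule 𝕜 (EuclideanSpace ℝ (Fin L) → EuclideanSpace 𝕜 (Fin d))) :
    Submodule 𝕜 (Lp (EuclideanSpace 𝕜 (Fin d)) 2 μ) where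
  carrier := {ψ | ∃ h ∈ H, ψ =ᵐ[μ] fun ω => h (Φ ω)}
  zero_mem' := ⟨0, H.zero_mem, Lp.coeFn_zero _ _ _⟩
  add_mem' := by
    rintro a b ⟨h, hh, ha⟩ ⟨k, hk, hb⟩
    refine ⟨h + k, H.add_mem hh hk, (Lp.coeFn_add a b).trans ?_⟩
    filter_upwards [ha, hb] with ω h1 h2
    simp [h1, h2]
  smul_mem' := by
    rintro c a ⟨h, hh, ha⟩
    refine ⟨c • h, H.smul_mem c hh, (Lp.coeFn_smul c a).trans ?_⟩
    filter_upwards [ha] with ω h1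
    simp [h1]

/-- Every `h ∘ Φ`, `h ∈ H`, is square integrable. -/
def IsSquareIntegrableClass (μ : Measure M) (Φ : M → EuclideanSpace ℝ (Fin L))
    (H : Submodule 𝕜 (EuclideanSpace ℝ (Fin L) → EuclideanSpace 𝕜 (Fin d))) : Prop :=
  ∀ h ∈ H, MemLp (fun ω => h (Φ ω)) 2 μ

/-- A hypothesis space: `𝒲` is a finite-dimensional subspace of `L²(μ)` that contains the
constants. -/
structure IsHypothesisSpace (μ : Measure M) [IsFiniteMeasure μ]
    (Φ : M → EuclideanSpace ℝ (Fin L))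
    (H : Submodule 𝕜 (EuclideanSpace ℝ (Fin L) → EuclideanSpace 𝕜 (Fin d))) : Prop where
  memLp : IsSquareIntegrableClass μ Φ H
  finiteDimensional : FiniteDimensional 𝕜 (hypSubspace μ Φ H)
  const_mem : ∀ c : EuclideanSpace 𝕜 (Fin d), Lp.const 2 μ c ∈ hypSubspace μ Φ H

/-- `wHat` is a closest approximation, in the `L²(μ)` distance after composition with `Φ`, of
`w : ℝ^L → ℝ^d` among the members of `H`. -/
def IsClosestApprox (μ : Measure M) (Φ : M → EuclideanSpace ℝ (Fin L))
    (H : Submodule 𝕜 (EuclideanSpace ℝ (Fin L) → EuclideanSpace 𝕜 (Fin d)))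
    (w : EuclideanSpace ℝ (Fin L) → EuclideanSpace ℝ (Fin d))
    (wHat : EuclideanSpace ℝ (Fin L) → EuclideanSpace 𝕜 (Fin d)) : Prop :=
  wHat ∈ H ∧ ∀ h ∈ H,
    eLpNorm (fun ω => ofRealVec 𝕜 (w (Φ ω)) - wHat (Φ ω)) 2 μ ≤
      eLpNorm (fun ω => ofRealVec 𝕜 (w (Φ ω)) - h (Φ ω)) 2 μ

/-- The direct forecast error `‖φ ∘ fⁿ - ŵ ∘ Φ‖_{L²(μ)}` at time `n` of an estimate `ŵ`. -/
noncomputable def directError (μ : Measure M) (f : M → M)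
    (φ : M → EuclideanSpace ℝ (Fin d)) (Φ : M → EuclideanSpace ℝ (Fin L))
    (wHat : EuclideanSpace ℝ (Fin L) → EuclideanSpace 𝕜 (Fin d)) (n : ℕ) : ℝ :=
  (eLpNorm (fun ω => ofRealVec 𝕜 (φ (f^[n] ω)) - wHat (Φ ω)) 2 μ).toReal

/-- The orthogonal projection `π` of `L²(μ; 𝕜^d)` onto `𝒲`. (An infinite-dimensional `𝒲` need
not be closed, and is replaced by its closure; a finite-dimensional one is closed.) -/
noncomputable def hypProj (μ : Measure M) (Φ : M → EuclideanSpace ℝ (Fin L))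
    (H : Submodule 𝕜 (EuclideanSpace ℝ (Fin L) → EuclideanSpace 𝕜 (Fin d))) :
    Lp (EuclideanSpace 𝕜 (Fin d)) 2 μ →L[𝕜] Lp (EuclideanSpace 𝕜 (Fin d)) 2 μ :=
  (hypSubspace μ Φ H).topologicalClosure.starProjection

end Hypothesis

section Observable

variable {M : Type*} [TopologicalSpace M] [SecondCountableTopology M] [MeasurableSpace M]
  [BorelSpace M] {μ : Measure M} [IsProbabilityMeasure μ] {d : ℕ}

/-- The measurement `φ` as an element of `L²(μ; 𝕜^d)`. -/
noncomputable def obsL2 (𝕜 : Type*) [RCLike 𝕜] (hμ : IsCompact μ.support)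
    {φ : M → EuclideanSpace ℝ (Fin d)} (hφ : Continuous φ) :
    Lp (EuclideanSpace 𝕜 (Fin d)) 2 μ :=
  (memLp_of_isCompact_support hμ ((continuous_ofRealVec 𝕜).comp hφ)).toLp

/-- The distance `‖φ - proj_𝒟 φ‖_{L²(μ)}` of the measurement to the space `𝒟`. -/
noncomputable def mixingResidual (hμ : IsCompact μ.support)
    {φ : M → EuclideanSpace ℝ (Fin d)} (hφ : Continuous φ) {f : M → M}
    (hf : MeasurePreserving f μ μ) : ℝ :=
  ‖obsL2 ℂ hμ hφ -
    (discreteSubspace (EuclideanSpace ℂ (Fin d)) hf).starProjection (obsL2 ℂ hμ hφ)‖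

end Observable

/-- The standard deviation `‖φ - μ(φ)‖_{L²(μ)}`. -/
noncomputable def stdDev {M : Type*} [MeasurableSpace M] {d : ℕ} (μ : Measure M)
    (φ : M → EuclideanSpace ℝ (Fin d)) : ℝ :=
  (eLpNorm (fun ω => φ ω - ∫ x, φ x ∂μ) 2 μ).toReal

end DirectForecast

open DirectForecast

/-! Because `w n ∘ Φ` agrees almost everywhere with `φ ∘ f^[n]`, the direct error is the distance of
`U^n φ` to `𝒲`. The theorem thus concerns the distance between an orbit of a linear isometry `U` of
a Hilbert space and a finite-dimensional subspace.

Split `φ = a + b`, with `a` the projection of `φ` onto the closed span of the finite-dimensional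
`U`-invariant subspaces. Over `ℂ` this span is `𝒟`; invariant subspaces replace eigenvectors because
a rotation of a real plane may have none, and with them one argument serves both fields.

Upper bound: approximate `a` by `ψ` in a finite-dimensional invariant `F`. If `F ≤ 𝒲`, then `U^n ψ`
is a competitor at every time, and the isometry gives error at most `‖φ - ψ‖` for all `n`. As `Φ` is
injective on a set of full measure, every finite-dimensional `F` containing the constants comes from
a hypothesis space.

Lower bound: `U^n b` tends weakly to zero along a set of density one, so its projection to any
finite-dimensional `𝒲` tends to zero in norm, and the forecast misses asymptotically at least `‖b‖`
(`eventually_lt_norm_sub_starProjection`).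

The weak convergence is the Koopman–von Neumann theorem (`tendsto_cesaro_inner`). A weak limit `K`
of the averages of the rank-one operators of `U^n b` is positive, of finite trace, hence compact,
and its quadratic form is `U`-invariant. If `K ≠ 0`, its top eigenspace is finite-dimensional and
invariant, hence orthogonal to the orbit of `b`, so the form of `K` vanishes there: a contradiction.
Under strong mixing, weak convergence holds along all times by density of simple functions. -/

namespace DirectForecast

/-! ### Positive and compact operators on a Hilbert space. -/

section Hilbert

variable {𝕜 E : Type*} [RCLike 𝕜] [NormedAddCommGroup E] [InnerProductSpace 𝕜 E]

/-- A bounded sequence of operators has a weak limit along every ultrafilter. -/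
theorem exists_weak_limit [CompleteSpace E] (u : Ultrafilter ℕ) (T : ℕ → E →L[𝕜] E) {C : ℝ}
    (hT : ∀ n, ‖T n‖ ≤ C) :
    ∃ K : E →L[𝕜] E, ∀ x y, Tendsto (fun n => inner 𝕜 (T n x) y) u (𝓝 (inner 𝕜 (K x) y)) := by
  have hb : ∀ x y n, ‖inner 𝕜 (T n x) y‖ ≤ C * ‖x‖ * ‖y‖ := fun x y n => by
    grw [norm_inner_le_norm, (T n).le_opNorm, hT n]
  have hlim : ∀ x y, ∃ l : 𝕜, ‖l‖ ≤ C * ‖x‖ * ‖y‖ ∧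
      Tendsto (fun n => inner 𝕜 (T n x) y) u (𝓝 l) := fun x y => by
    obtain ⟨l, hl, h⟩ := (isCompact_closedBall (0 : 𝕜) (C * ‖x‖ * ‖y‖)).ultrafilter_le_nhds
      (u.map fun n => inner 𝕜 (T n x) y) (by
        rw [Ultrafilter.coe_map, le_principal_iff, mem_map]
        exact Filter.univ_mem' fun n => by simpa using hb x y n)
    exact ⟨l, by simpa using hl, h⟩
  choose l hlb hl using hlim
  let B : E →ₗ⋆[𝕜] E →ₗ[𝕜] 𝕜 := LinearMap.mk₂'ₛₗ (starRingEnd 𝕜) (RingHom.id 𝕜) l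
    (fun a b y => tendsto_nhds_unique (hl _ _)
      (((hl a y).add (hl b y)).congr fun n => by rw [map_add, inner_add_left]))
    (fun c a y => tendsto_nhds_unique (hl _ _)
      (((hl a y).const_smul ((starRingEnd 𝕜) c)).congr fun n => by
        rw [map_smul, inner_smul_left, smul_eq_mul]))
    (fun a x y => tendsto_nhds_unique (hl _ _)
      (((hl a x).add (hl a y)).congr fun n => by rw [inner_add_right]))
    (fun c a y => tendsto_nhds_unique (hl _ _)
      (((hl a y).const_smul c).congr fun n => by
        rw [inner_smul_right, smul_eq_mul]))
  refine ⟨InnerProductSpace.continuousLinearMapOfBilin (B.mkContinuous₂ C hlb), fun x y => ?_⟩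
  rw [InnerProductSpace.continuousLinearMapOfBilin_apply]
  exact hl x y

/-- Obtained by evaluating the nonnegative form at `y - ‖K‖⁻¹ K y`. It turns smallness of the
quadratic form into smallness of `K y`. -/
theorem _root_.ContinuousLinearMap.IsPositive.norm_apply_sq_le {K : E →L[𝕜] E} (hK : K.IsPositive)
    (y : E) : ‖K y‖ ^ 2 ≤ ‖K‖ * RCLike.re (inner 𝕜 (K y) y) := by
  rcases eq_or_ne K 0 with rfl | h0
  · simp
  have hpos : 0 < ‖K‖ := norm_pos_iff.2 h0
  have h := hK.re_inner_nonneg_left (y - ((‖K‖⁻¹ : ℝ) : 𝕜) • K y)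
  have h2 : RCLike.re (inner 𝕜 (K (K y)) (K y)) ≤ ‖K‖ * ‖K y‖ ^ 2 := by
    grw [RCLike.re_le_norm, norm_inner_le_norm, K.le_opNorm]
    exact le_of_eq (by ring)
  have h3 : inner 𝕜 (K (K y)) y = inner 𝕜 (K y) (K y) := hK.inner_left_eq_inner_right _ _
  simp only [map_sub, map_smul, inner_sub_left, inner_sub_right, inner_smul_left,
    inner_smul_right, h3, RCLike.conj_ofReal, RCLike.re_ofReal_mul, inner_self_eq_norm_sq] at h
  have h4 : ‖K‖⁻¹ * (‖K‖⁻¹ * RCLike.re (inner 𝕜 (K (K y)) (K y))) ≤ ‖K‖⁻¹ * ‖K y‖ ^ 2 := by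
    grw [h2]
    rw [inv_mul_cancel_left₀ hpos.ne']
  have h5 : ‖K‖⁻¹ * ‖K y‖ ^ 2 ≤ RCLike.re (inner 𝕜 (K y) y) := by linarith
  rwa [inv_mul_le_iff₀ hpos] at h5

/-- A positive operator of finite trace is compact. -/
theorem _root_.ContinuousLinearMap.IsPositive.isCompactOperator_of_trace_le [CompleteSpace E]
    {K : E →L[𝕜] E} (hK : K.IsPositive) {C : ℝ}
    (hC : ∀ (n : ℕ) (e : Fin n → E), Orthonormal 𝕜 e →
      ∑ i, RCLike.re (inner 𝕜 (K (e i)) (e i)) ≤ C) : IsCompactOperator K := by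
  -- Off some finite-dimensional space the form is at most `ε`. Otherwise unit vectors with form at
  -- least `ε`, each orthogonal to the previous ones, can be chosen indefinitely, and `n` of them
  -- force `n * ε ≤ C`.
  have key : ∀ ε : ℝ, 0 < ε → ∃ F : Submodule 𝕜 E, FiniteDimensional 𝕜 F ∧
      ∀ x ∈ Fᗮ, RCLike.re (inner 𝕜 (K x) x) ≤ ε * ‖x‖ ^ 2 := by
    intro ε hε
    by_contra! hcon
    have hfam : ∀ n : ℕ, ∃ e : Fin n → E, Orthonormal 𝕜 e ∧
        ∀ i, ε ≤ RCLike.re (inner 𝕜 (K (e i)) (e i)) := by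
      intro n
      induction n with
      | zero => exact ⟨Fin.elim0, ⟨fun i => i.elim0, fun i => i.elim0⟩, fun i => i.elim0⟩
      | succ n ih =>
        obtain ⟨e, he, hq⟩ := ih
        obtain ⟨x, hx, hxq⟩ := hcon (Submodule.span 𝕜 (Set.range e))
          (FiniteDimensional.span_of_finite 𝕜 (Set.finite_range e))
        have hx0 : x ≠ 0 := by rintro rfl; simp at hxq
        have hxpos : 0 < ‖x‖ := norm_pos_iff.2 hx0
        set z : E := ((‖x‖⁻¹ : ℝ) : 𝕜) • x with hz
        have hzn : ‖z‖ = 1 := by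
          rw [hz, norm_smul, RCLike.norm_ofReal, abs_of_pos (inv_pos.2 hxpos),
            inv_mul_cancel₀ hxpos.ne']
        have hez : ∀ i, inner 𝕜 (e i) z = 0 := fun i => by
          rw [hz, inner_smul_right, (Submodule.mem_orthogonal _ _).1 hx _
            (Submodule.subset_span ⟨i, rfl⟩), mul_zero]
        have hze : ∀ i, inner 𝕜 z (e i) = 0 := fun i => inner_eq_zero_symm.1 (hez i)
        refine ⟨Fin.cons z e, ⟨fun i => ?_, fun i j => ?_⟩, fun i => ?_⟩
        · refine Fin.cases ?_ (fun i => ?_) i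
          · simpa using hzn
          · simpa using he.1 i
        · refine Fin.cases ?_ (fun i => ?_) i <;> refine Fin.cases ?_ (fun j => ?_) j
          · simp
          · intro _
            simpa only [Fin.cons_zero, Fin.cons_succ] using hze j
          · intro _
            simpa only [Fin.cons_zero, Fin.cons_succ] using hez i
          · intro hij
            simpa using he.2 (fun h => hij (by rw [h]))
        · refine Fin.cases ?_ (fun i => ?_) i
          · simp only [Fin.cons_zero, hz, map_smul, inner_smul_left, inner_smul_right,
              RCLike.conj_ofReal, RCLike.re_ofReal_mul]
            have : ε = ‖x‖⁻¹ * (‖x‖⁻¹ * (ε * ‖x‖ ^ 2)) := by field_simp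
            rw [this]
            gcongr
          · simpa using hq i
    obtain ⟨n, hn⟩ := exists_nat_gt (C / ε)
    obtain ⟨e, he, hq⟩ := hfam n
    have h1 : (n : ℝ) * ε ≤ C := by
      refine le_trans ?_ (hC n e he)
      calc (n : ℝ) * ε = ∑ _i : Fin n, ε := by simp
        _ ≤ _ := Finset.sum_le_sum fun i _ => hq i
    rw [div_lt_iff₀ hε] at hn
    linarith
  -- Compact operators are closed in norm, and `K` is approximated by `K` composed with the
  -- projection onto `F`.
  refine isClosed_setOfPred_isCompactOperator.closure_subset (Metric.mem_closure_iff.2 ?_)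
  intro ε hε
  -- With this constant `norm_apply_sq_le` yields `‖K x‖ ≤ (ε / 2) ‖x‖` on `Fᗮ`; the `+ 1` avoids
  -- division by zero.
  obtain ⟨F, hF, hFq⟩ := key ((ε / 2) ^ 2 / (‖K‖ + 1)) (by positivity)
  refine ⟨K.comp F.starProjection, ?_, ?_⟩
  · have hP : IsCompactOperator F.starProjection := by
      have : ProperSpace F := FiniteDimensional.proper_rclike 𝕜 F
      have h : IsCompactOperator F.orthogonalProjectionOnto :=
        isCompactOperator_of_locallyCompactSpace_dom F.orthogonalProjectionOnto
      exact h.clm_comp F.subtypeL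
    exact hP.clm_comp K
  · rw [dist_eq_norm]
    refine lt_of_le_of_lt (ContinuousLinearMap.opNorm_le_bound _ (half_pos hε).le fun x => ?_)
      (half_lt_self hε)
    have hmem : x - F.starProjection x ∈ Fᗮ := F.sub_starProjection_mem_orthogonal x
    have hle : ‖x - F.starProjection x‖ ≤ ‖x‖ := by
      have := Fᗮ.norm_starProjection_apply_le x
      rwa [Submodule.starProjection_orthogonal_val] at this
    have h1 : (K - K.comp F.starProjection) x = K (x - F.starProjection x) := by simp
    rw [h1]
    refine le_of_sq_le_sq ?_ (by positivity)
    calc ‖K (x - F.starProjection x)‖ ^ 2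
        ≤ ‖K‖ * ((ε / 2) ^ 2 / (‖K‖ + 1) * ‖x - F.starProjection x‖ ^ 2) := by
          grw [hK.norm_apply_sq_le, hFq _ hmem]
      _ ≤ (‖K‖ + 1) * ((ε / 2) ^ 2 / (‖K‖ + 1) * ‖x‖ ^ 2) := by gcongr; linarith
      _ = (ε / 2 * ‖x‖) ^ 2 := by
          have : ‖K‖ + 1 ≠ 0 := by positivity
          field_simp

/-- A nonzero positive compact operator has its norm as an eigenvalue. -/
theorem _root_.ContinuousLinearMap.IsPositive.hasEigenvalue_norm [CompleteSpace E] {K : E →L[𝕜] E}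
    (hK : K.IsPositive) (hc : IsCompactOperator K) (h0 : K ≠ 0) :
    Module.End.HasEigenvalue (K : Module.End 𝕜 E) (‖K‖ : 𝕜) := by
  have hpos : 0 < ‖K‖ := norm_pos_iff.2 h0
  rw [hc.hasEigenvalue_iff_mem_spectrum (by exact_mod_cast hpos.ne')]
  by_contra hmem
  have : Nontrivial E := by
    by_contra hE
    rw [not_nontrivial_iff_subsingleton] at hE
    exact h0 (Subsingleton.elim _ _)
  -- If `‖K‖` were in the resolvent set, the Rayleigh quotients would stay below `‖K‖ - ε`, whereas
  -- for symmetric `K` the supremum of their absolute values is `‖K‖`.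
  obtain ⟨ε, hε, hq⟩ := K.rayleighQuotient_le_of_norm_mem_resolventSet
    (not_not.1 hmem)
  have h1 : ‖K‖ ≤ ‖K‖ - ε := by
    conv_lhs => rw [K.norm_eq_iSup_rayleighQuotient hK.isSymmetric]
    refine ciSup_le fun x => ?_
    have hx : 0 ≤ K.rayleighQuotient x :=
      div_nonneg (hK.re_inner_nonneg_left x) (by positivity)
    exact (abs_of_nonneg hx).trans_le (hq x)
  linarith

/-- Expanding the square shows `‖K x - ‖K‖ x‖² ≤ 0`. The top eigenspace is thus determined by the
quadratic form, so an isometry preserving the form preserves this eigenspace. -/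
theorem _root_.ContinuousLinearMap.mem_eigenspace_norm {K : E →L[𝕜] E}
    {x : E} (hx : RCLike.re (inner 𝕜 (K x) x) = ‖K‖ * ‖x‖ ^ 2) :
    x ∈ Module.End.eigenspace (K : Module.End 𝕜 E) (‖K‖ : 𝕜) := by
  rw [Module.End.mem_eigenspace_iff, ← sub_eq_zero, ← norm_eq_zero]
  have h : ‖K x - (‖K‖ : 𝕜) • x‖ ^ 2 ≤ 0 := by
    rw [norm_sub_sq (𝕜 := 𝕜), inner_smul_right, RCLike.re_ofReal_mul, hx, norm_smul,
      RCLike.norm_ofReal, abs_norm]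
    have := pow_le_pow_left₀ (norm_nonneg _) (K.le_opNorm x) 2
    nlinarith
  exact pow_eq_zero_iff (two_ne_zero) |>.1 (le_antisymm h (by positivity))

theorem _root_.ContinuousLinearMap.re_inner_apply_of_mem_eigenspace_norm {K : E →L[𝕜] E} {x : E}
    (hx : x ∈ Module.End.eigenspace (K : Module.End 𝕜 E) (‖K‖ : 𝕜)) :
    RCLike.re (inner 𝕜 (K x) x) = ‖K‖ * ‖x‖ ^ 2 := by
  have h : K x = (‖K‖ : 𝕜) • x := Module.End.mem_eigenspace_iff.1 hx
  rw [h, inner_smul_left, RCLike.conj_ofReal, RCLike.re_ofReal_mul, inner_self_eq_norm_sq]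

/-! ### Finite-dimensional invariant subspaces and the Koopman–von Neumann theorem. -/

/-- A finite-dimensional subspace mapped into itself by `U`. -/
def IsFinInvariant (U : E →ₗᵢ[𝕜] E) (F : Submodule 𝕜 E) : Prop :=
  FiniteDimensional 𝕜 F ∧ ∀ x ∈ F, U x ∈ F

theorem IsFinInvariant.sup {U : E →ₗᵢ[𝕜] E} {F G : Submodule 𝕜 E} (hF : IsFinInvariant U F)
    (hG : IsFinInvariant U G) : IsFinInvariant U (F ⊔ G) := by
  have := hF.1
  have := hG.1
  refine ⟨inferInstance, fun x hx => ?_⟩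
  obtain ⟨a, ha, b, hb, rfl⟩ := Submodule.mem_sup.1 hx
  rw [map_add]
  exact Submodule.add_mem_sup (hF.2 a ha) (hG.2 b hb)

theorem IsFinInvariant.exists_apply_eq {U : E →ₗᵢ[𝕜] E} {F : Submodule 𝕜 E}
    (hF : IsFinInvariant U F) {y : E} (hy : y ∈ F) : ∃ z ∈ F, U z = y := by
  have := hF.1
  let V : F →ₗ[𝕜] F := U.toLinearMap.restrict hF.2
  have hV : Function.Injective V := fun a b hab =>
    Subtype.ext (U.injective (congrArg Subtype.val hab))
  obtain ⟨z, hz⟩ := (LinearMap.injective_iff_surjective.1 hV) ⟨y, hy⟩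
  exact ⟨z, z.2, congrArg Subtype.val hz⟩

/-- `U` need not be surjective, but its restriction to `F` is, being injective in finite dimension;
so every test vector in `F` has the form `U z` with `z ∈ F`. -/
theorem IsFinInvariant.apply_mem_orthogonal {U : E →ₗᵢ[𝕜] E} {F : Submodule 𝕜 E}
    (hF : IsFinInvariant U F) {x : E} (hx : x ∈ Fᗮ) : U x ∈ Fᗮ := by
  rw [Submodule.mem_orthogonal] at hx ⊢
  intro y hy
  obtain ⟨z, hz, rfl⟩ := hF.exists_apply_eq hy
  rw [U.inner_map_map]
  exact hx z hz

/-- The union of the finite-dimensional invariant subspaces. -/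
def finInvariantSpan (U : E →ₗᵢ[𝕜] E) : Submodule 𝕜 E where
  carrier := {x | ∃ F, IsFinInvariant U F ∧ x ∈ F}
  zero_mem' := ⟨⊥, ⟨inferInstance, by simp⟩, Submodule.zero_mem _⟩
  add_mem' := by
    rintro a b ⟨F, hF, ha⟩ ⟨G, hG, hb⟩
    exact ⟨F ⊔ G, hF.sup hG, Submodule.add_mem_sup ha hb⟩
  smul_mem' := by
    rintro c a ⟨F, hF, ha⟩
    exact ⟨F, hF, F.smul_mem c ha⟩

theorem mem_finInvariantSpan {U : E →ₗᵢ[𝕜] E} {x : E} :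
    x ∈ finInvariantSpan U ↔ ∃ F, IsFinInvariant U F ∧ x ∈ F := Iff.rfl

/-- The closed span of the finite-dimensional invariant subspaces. -/
abbrev compactSubspace (U : E →ₗᵢ[𝕜] E) : Submodule 𝕜 E :=
  (finInvariantSpan U).topologicalClosure

theorem iterate_mem_orthogonal {U : E →ₗᵢ[𝕜] E} {F : Submodule 𝕜 E}
    (hF : IsFinInvariant U F) {x : E} (hx : x ∈ Fᗮ) (n : ℕ) : U^[n] x ∈ Fᗮ := by
  induction n with
  | zero => exact hx
  | succ n ih => rw [Function.iterate_succ_apply']; exact hF.apply_mem_orthogonal ih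

theorem norm_iterate (U : E →ₗᵢ[𝕜] E) (n : ℕ) (x : E) : ‖U^[n] x‖ = ‖x‖ := by
  induction n with
  | zero => rfl
  | succ n ih => rw [Function.iterate_succ_apply', U.norm_map, ih]

/-- **Koopman–von Neumann**: an orbit orthogonal to all finite-dimensional invariant subspaces has
vanishing quadratic correlations on average. -/
theorem tendsto_cesaro_inner [CompleteSpace E] (U : E →ₗᵢ[𝕜] E) {v : E}
    (hv : v ∈ (compactSubspace U)ᗮ) (w : E) :
    Tendsto (fun N : ℕ => (N : ℝ)⁻¹ * ∑ n ∈ Finset.range N, ‖inner 𝕜 (U^[n] v) w‖ ^ 2)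
      atTop (𝓝 0) := by
  rw [tendsto_iff_ultrafilter]
  intro u hu
  -- The quadratic form of `T N` at `x` is the Cesàro mean to be controlled; it suffices that every
  -- ultrafilter limit `K` of the `T N` is zero.
  let T : ℕ → E →L[𝕜] E := fun N => (((N : ℝ)⁻¹ : ℝ) : 𝕜) •
    ∑ n ∈ Finset.range N, InnerProductSpace.rankOne 𝕜 (U^[n] v) (U^[n] v)
  have hTi : ∀ N x y, inner 𝕜 (T N x) y = (((N : ℝ)⁻¹ : ℝ) : 𝕜) *
      ∑ n ∈ Finset.range N, inner 𝕜 x (U^[n] v) * inner 𝕜 (U^[n] v) y := by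
    intro N x y
    simp only [T, smul_apply, inner_smul_left, RCLike.conj_ofReal,
      sum_apply, sum_inner, InnerProductSpace.rankOne_apply,
      inner_conj_symm]
  have hTq : ∀ N x, RCLike.re (inner 𝕜 (T N x) x) =
      (N : ℝ)⁻¹ * ∑ n ∈ Finset.range N, ‖inner 𝕜 (U^[n] v) x‖ ^ 2 := by
    intro N x
    rw [hTi, RCLike.re_ofReal_mul, map_sum]
    congr 1
    refine Finset.sum_congr rfl fun n _ => ?_
    rw [← inner_conj_symm, RCLike.conj_mul, ← RCLike.ofReal_pow, RCLike.ofReal_re]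
  have hTn : ∀ N, ‖T N‖ ≤ ‖v‖ ^ 2 := by
    intro N
    rcases Nat.eq_zero_or_pos N with rfl | hN
    · simp [T]
    have hN' : (0 : ℝ) < N := by exact_mod_cast hN
    simp only [T]
    rw [norm_smul, RCLike.norm_ofReal, abs_of_pos (inv_pos.2 hN'), inv_mul_le_iff₀ hN']
    refine (norm_sum_le _ _).trans ?_
    refine (Finset.sum_le_card_nsmul _ _ (‖v‖ ^ 2) fun n _ => ?_).trans_eq (by simp)
    refine ContinuousLinearMap.opNorm_le_bound _ (by positivity) fun x => ?_
    rw [InnerProductSpace.rankOne_apply, norm_smul]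
    grw [norm_inner_le_norm]
    rw [norm_iterate]
    exact le_of_eq (by ring)
  obtain ⟨K, hK⟩ := exists_weak_limit u T hTn
  have hKq : ∀ x, Tendsto (fun N : ℕ => (N : ℝ)⁻¹ *
      ∑ n ∈ Finset.range N, ‖inner 𝕜 (U^[n] v) x‖ ^ 2) u (𝓝 (RCLike.re (inner 𝕜 (K x) x))) := by
    intro x
    exact ((RCLike.continuous_re.tendsto _).comp (hK x x)).congr fun N => hTq N x
  have hsymm : K.IsSymmetric := by
    intro x y
    refine tendsto_nhds_unique (hK x y) ?_
    have h := (RCLike.continuous_conj.tendsto _).comp (hK y x)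
    rw [inner_conj_symm] at h
    refine h.congr fun N => ?_
    simp only [Function.comp_apply, hTi, map_mul, RCLike.conj_ofReal, map_sum, inner_conj_symm]
    congr 1
    exact Finset.sum_congr rfl fun n _ => mul_comm _ _
  have hpos : K.IsPositive := by
    refine ⟨hsymm, fun x => ge_of_tendsto (hKq x) (Eventually.of_forall fun N => by positivity)⟩
  -- Bessel's inequality for each `U^n v` bounds the trace of each `T N`, and this passes to the
  -- limit.
  have htr : ∀ (n : ℕ) (e : Fin n → E), Orthonormal 𝕜 e →
      ∑ i, RCLike.re (inner 𝕜 (K (e i)) (e i)) ≤ ‖v‖ ^ 2 := by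
    intro n e he
    refine le_of_tendsto (tendsto_finsetSum _ fun i _ => hKq (e i)) (Eventually.of_forall fun N => ?_)
    rw [← Finset.mul_sum, Finset.sum_comm]
    rcases Nat.eq_zero_or_pos N with rfl | hN
    · simp
    have hN' : (0 : ℝ) < N := by exact_mod_cast hN
    rw [inv_mul_le_iff₀ hN']
    refine (Finset.sum_le_card_nsmul _ _ (‖v‖ ^ 2) fun k _ => ?_).trans_eq (by simp)
    rw [← norm_iterate U k v]
    simpa only [norm_inner_symm] using he.sum_inner_products_le (U^[k] v) (s := Finset.univ)
  have hcomp : IsCompactOperator K := hpos.isCompactOperator_of_trace_le htr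
  -- Replacing `x` by `U x` shifts the time index by one, so the two sums telescope to two bounded
  -- boundary terms, which vanish after division by `N`.
  have hinv : ∀ x, RCLike.re (inner 𝕜 (K (U x)) (U x)) = RCLike.re (inner 𝕜 (K x) x) := by
    intro x
    rw [← sub_eq_zero]
    refine tendsto_nhds_unique ((hKq (U x)).sub (hKq x)) ?_
    refine Tendsto.mono_left ?_ hu
    have hC : Tendsto (fun N : ℕ => (N : ℝ)⁻¹ * (‖v‖ * ‖x‖) ^ 2) atTop (𝓝 0) := by
      simpa using (tendsto_inv_atTop_nhds_zero_nat (𝕜 := ℝ)).mul_const ((‖v‖ * ‖x‖) ^ 2)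
    refine squeeze_zero_norm (fun N => ?_) hC
    have hs : ∑ n ∈ Finset.range N, ‖inner 𝕜 (U^[n] v) (U x)‖ ^ 2 -
        ∑ n ∈ Finset.range N, ‖inner 𝕜 (U^[n] v) x‖ ^ 2 =
        ‖inner 𝕜 v (U x)‖ ^ 2 - ‖inner 𝕜 (U^[N] v) (U x)‖ ^ 2 := by
      have h1 := Finset.sum_range_succ (fun n => ‖inner 𝕜 (U^[n] v) (U x)‖ ^ 2) N
      have h2 := Finset.sum_range_succ' (fun n => ‖inner 𝕜 (U^[n] v) (U x)‖ ^ 2) N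
      simp only [Function.iterate_succ_apply', U.inner_map_map, Function.iterate_zero_apply] at h2
      linarith
    have hb : ∀ n, ‖inner 𝕜 (U^[n] v) (U x)‖ ^ 2 ≤ (‖v‖ * ‖x‖) ^ 2 := fun n => by
      grw [norm_inner_le_norm, norm_iterate, U.norm_map]
    rw [← mul_sub, hs, norm_mul, norm_inv, Real.norm_natCast]
    gcongr
    rw [Real.norm_eq_abs, abs_sub_le_iff]
    have h1 := hb 0
    have h2 := hb N
    have h3 : 0 ≤ ‖inner 𝕜 v (U x)‖ ^ 2 := by positivity
    have h4 : 0 ≤ ‖inner 𝕜 (U^[N] v) (U x)‖ ^ 2 := by positivity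
    rw [Function.iterate_zero_apply] at h1
    constructor <;> linarith
  have hK0 : K = 0 := by
    by_contra h0
    have hnpos : 0 < ‖K‖ := norm_pos_iff.2 h0
    have hF : IsFinInvariant U (Module.End.eigenspace (K : Module.End 𝕜 E) (‖K‖ : 𝕜)) := by
      refine ⟨ContinuousLinearMap.finite_dimensional_eigenspace hcomp _
        (by exact_mod_cast hnpos.ne'), fun x hx => ContinuousLinearMap.mem_eigenspace_norm ?_⟩
      rw [hinv, ContinuousLinearMap.re_inner_apply_of_mem_eigenspace_norm hx, U.norm_map]
    obtain ⟨x, hx, hx0⟩ := (hpos.hasEigenvalue_norm hcomp h0).exists_hasEigenvector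
    have hvF : v ∈ (Module.End.eigenspace (K : Module.End 𝕜 E) (‖K‖ : 𝕜))ᗮ :=
      Submodule.orthogonal_le (fun y hy => Submodule.le_topologicalClosure _
        (mem_finInvariantSpan.2 ⟨_, hF, hy⟩)) hv
    have hz : RCLike.re (inner 𝕜 (K x) x) = 0 := by
      refine tendsto_nhds_unique (hKq x) (tendsto_const_nhds.congr fun N => ?_)
      rw [Finset.sum_eq_zero, mul_zero]
      intro n _
      rw [(Submodule.mem_orthogonal' _ _).1 (iterate_mem_orthogonal hF hvF n) x hx]
      simp
    rw [ContinuousLinearMap.re_inner_apply_of_mem_eigenspace_norm hx] at hz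
    have : 0 < ‖x‖ := norm_pos_iff.2 hx0
    nlinarith [mul_pos hnpos (pow_pos this 2)]
  simpa [hK0] using hKq w

end Hilbert

/-! ### Natural density and Cesàro means. -/

theorem ncard_inter_Iio (A : Set ℕ) [DecidablePred (· ∈ A)] (N : ℕ) :
    (A ∩ Set.Iio N).ncard = ((Finset.range N).filter (· ∈ A)).card := by
  rw [← Set.ncard_coe_finset]
  congr 1
  ext n
  simp [and_comm]

theorem hasDensityOne_univ : HasDensityOne Set.univ := by
  refine tendsto_const_nhds.congr' ?_
  filter_upwards [eventually_gt_atTop 0] with N hN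
  have : ((Set.univ ∩ Set.Iio N : Set ℕ)).ncard = N := by
    classical
    rw [ncard_inter_Iio]
    simp
  rw [this, div_self (by exact_mod_cast hN.ne')]

/-- A nonnegative sequence that tends to zero in the sense of Cesàro tends to zero along a set of
density one. -/
theorem exists_hasDensityOne_tendsto {a : ℕ → ℝ} (ha : ∀ n, 0 ≤ a n)
    (h : Tendsto (fun N : ℕ => (N : ℝ)⁻¹ * ∑ n ∈ Finset.range N, a n) atTop (𝓝 0)) :
    ∃ A, HasDensityOne A ∧ Tendsto a (atTop ⊓ 𝓟 A) (𝓝 0) := by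
  classical
  set b : ℕ → ℝ := fun N => (N : ℝ)⁻¹ * ∑ n ∈ Finset.range N, a n with hb
  obtain ⟨C, hC⟩ := h.bddAbove_range
  have hbdd : ∀ N, BddAbove (Set.range fun m => b (N + m)) := fun N =>
    ⟨C, by rintro _ ⟨m, rfl⟩; exact hC ⟨_, rfl⟩⟩
  have hb0 : ∀ N, 0 ≤ b N := fun N =>
    mul_nonneg (by positivity) (Finset.sum_nonneg fun n _ => ha n)
  -- The supremum over the tail makes `s` an antitone majorant of `b` that still tends to zero; the
  -- extra summand makes it positive, so that `√(s N)` can be cancelled.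
  set s : ℕ → ℝ := fun N => (⨆ m, b (N + m)) + 1 / ((N : ℝ) + 1) with hs
  have hbs : ∀ N, b N ≤ s N := fun N => by
    have h1 : b N ≤ ⨆ m, b (N + m) := le_ciSup (hbdd N) 0
    have h2 : (0 : ℝ) ≤ 1 / ((N : ℝ) + 1) := by positivity
    simp only [hs]
    linarith
  have hspos : ∀ N, 0 < s N := fun N => by
    have h1 : 0 ≤ ⨆ m, b (N + m) := Real.iSup_nonneg fun m => hb0 _
    have h2 : (0 : ℝ) < 1 / ((N : ℝ) + 1) := by positivity
    simp only [hs]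
    linarith
  have hanti : Antitone s := by
    intro M N hMN
    simp only [hs]
    refine add_le_add (ciSup_le fun m => ?_) ?_
    · obtain ⟨k, rfl⟩ := Nat.exists_eq_add_of_le hMN
      rw [add_assoc]
      exact le_ciSup (hbdd M) (k + m)
    · have : (M : ℝ) ≤ N := by exact_mod_cast hMN
      gcongr
  have hs0 : Tendsto s atTop (𝓝 0) := by
    have h1 : Tendsto (fun N => ⨆ m, b (N + m)) atTop (𝓝 0) := by
      rw [Metric.tendsto_atTop]
      intro ε hε
      obtain ⟨N, hN⟩ := (Metric.tendsto_atTop.1 h) (ε / 2) (half_pos hε)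
      refine ⟨N, fun n hn => ?_⟩
      rw [Real.dist_0_eq_abs, abs_of_nonneg (Real.iSup_nonneg fun m => hb0 _)]
      refine lt_of_le_of_lt (ciSup_le fun m => ?_) (half_lt_self hε)
      have := hN (n + m) (by omega)
      rw [Real.dist_0_eq_abs] at this
      exact (le_abs_self _).trans this.le
    simpa only [add_zero] using h1.add (tendsto_one_div_add_atTop_nhds_zero_nat (𝕜 := ℝ))
  have hr0 : Tendsto (fun N => √(s N)) atTop (𝓝 0) := by
    simpa using hs0.sqrt
  -- Markov's inequality: each exceptional `n < N` has `a n ≥ √(s n) ≥ √(s N)`, while these values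
  -- sum to at most `N * s N`, so there are at most `N * √(s N)` of them.
  refine ⟨{n | a n < √(s n)}, ?_, ?_⟩
  · have hcount : ∀ N : ℕ, 0 < N →
        1 - √(s N) ≤ (({n | a n < √(s n)} ∩ Set.Iio N).ncard : ℝ) / N := by
      intro N hN
      have hN' : (0 : ℝ) < N := by exact_mod_cast hN
      rw [ncard_inter_Iio, le_div_iff₀ hN']
      have hsplit := Finset.card_filter_add_card_filter_not (s := Finset.range N)
        (fun n => n ∈ {n | a n < √(s n)})
      rw [Finset.card_range] at hsplit
      have hsplit' : (((Finset.range N).filter fun n => n ∈ {n | a n < √(s n)}).card : ℝ) +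
          (((Finset.range N).filter fun n => ¬ n ∈ {n | a n < √(s n)}).card : ℝ) = N := by
        exact_mod_cast hsplit
      set J := (Finset.range N).filter fun n => ¬ n ∈ {n | a n < √(s n)}
      have hJ : (J.card : ℝ) * √(s N) ≤ N * s N := by
        calc (J.card : ℝ) * √(s N) = ∑ _n ∈ J, √(s N) := by simp
          _ ≤ ∑ n ∈ J, a n := by
            refine Finset.sum_le_sum fun n hn => ?_
            obtain ⟨hn1, hn2⟩ := Finset.mem_filter.1 hn
            refine le_trans (Real.sqrt_le_sqrt (hanti (Finset.mem_range.1 hn1).le)) ?_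
            simpa using hn2
          _ ≤ ∑ n ∈ Finset.range N, a n :=
            Finset.sum_le_sum_of_subset_of_nonneg (Finset.filter_subset _ _) fun n _ _ => ha n
          _ = N * b N := by simp only [hb]; field_simp
          _ ≤ N * s N := by gcongr; exact hbs N
      have hpos : 0 < √(s N) := Real.sqrt_pos.2 (hspos N)
      have hJ' : (J.card : ℝ) ≤ N * √(s N) := by
        refine le_of_mul_le_mul_right ?_ hpos
        rwa [mul_assoc, Real.mul_self_sqrt (hspos N).le]
      linarith
    refine tendsto_of_tendsto_of_tendsto_of_le_of_le' (g := fun N => 1 - √(s N))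
      (h := fun _ => (1 : ℝ)) ?_ tendsto_const_nhds ?_ ?_
    · simpa using hr0.const_sub 1
    · filter_upwards [eventually_gt_atTop 0] with N hN using hcount N hN
    · filter_upwards [eventually_gt_atTop 0] with N hN
      refine div_le_one_of_le₀ ?_ (by positivity)
      rw [ncard_inter_Iio]
      exact_mod_cast (Finset.card_filter_le _ _).trans_eq (Finset.card_range N)
  · refine tendsto_of_tendsto_of_tendsto_of_le_of_le' tendsto_const_nhds
      (hr0.mono_left inf_le_left) (Eventually.of_forall ha) ?_
    exact mem_inf_of_right (mem_principal.2 fun n (hn : a n < √(s n)) => hn.le)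

/-! ### Weak convergence along density-one sets, and distances of orbits to subspaces. -/

section Hilbert

variable {𝕜 E : Type*} [RCLike 𝕜] [NormedAddCommGroup E] [InnerProductSpace 𝕜 E]

/-- The vectors to which a sequence `x` becomes orthogonal along the filter `l`. -/
def asymptoticOrthogonal (𝕜 : Type*) {E : Type*} [RCLike 𝕜] [NormedAddCommGroup E]
    [InnerProductSpace 𝕜 E] (l : Filter ℕ) (x : ℕ → E) : Submodule 𝕜 E where
  carrier := {w | Tendsto (fun n => inner 𝕜 (x n) w) l (𝓝 0)}
  zero_mem' := by simpa using tendsto_const_nhds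
  add_mem' := fun {a b} ha hb => by
    simpa [inner_add_right] using Tendsto.add (f := fun n => inner 𝕜 (x n) a) ha hb
  smul_mem' := fun c a ha => by
    simpa [inner_smul_right] using Tendsto.const_mul (f := fun n => inner 𝕜 (x n) a) c ha

theorem isClosed_asymptoticOrthogonal {l : Filter ℕ} {x : ℕ → E} {C : ℝ} (hx : ∀ n, ‖x n‖ ≤ C) :
    IsClosed (asymptoticOrthogonal 𝕜 l x : Set E) := by
  refine isClosed_of_closure_subset fun w hw => ?_
  have hC : 0 ≤ C := (norm_nonneg _).trans (hx 0)
  change Tendsto (fun n => inner 𝕜 (x n) w) l (𝓝 0)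
  rw [Metric.tendsto_nhds]
  intro ε hε
  obtain ⟨z, hz, hwz⟩ := Metric.mem_closure_iff.1 hw (ε / 2 / (C + 1)) (by positivity)
  have hz' : Tendsto (fun n => inner 𝕜 (x n) z) l (𝓝 0) := hz
  filter_upwards [(Metric.tendsto_nhds.1 hz') (ε / 2) (half_pos hε)] with n hn
  rw [dist_zero_right] at hn ⊢
  rw [dist_eq_norm, lt_div_iff₀ (by positivity)] at hwz
  have h1 : inner 𝕜 (x n) w = inner 𝕜 (x n) (w - z) + inner 𝕜 (x n) z := by
    rw [inner_sub_right, sub_add_cancel]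
  have h2 : ‖inner 𝕜 (x n) (w - z)‖ ≤ ‖w - z‖ * (C + 1) := by
    grw [norm_inner_le_norm, hx n, mul_comm]
    gcongr
    linarith
  rw [h1]
  grw [norm_add_le]
  linarith

/-- An orbit orthogonal to all finite-dimensional invariant subspaces converges weakly to zero
along a set of times of density one. -/
theorem exists_hasDensityOne_tendsto_inner [CompleteSpace E] (U : E →ₗᵢ[𝕜] E) {v : E}
    (hv : v ∈ (compactSubspace U)ᗮ) :
    ∃ A, HasDensityOne A ∧
      ∀ w, Tendsto (fun n => inner 𝕜 (U^[n] v) w) (atTop ⊓ 𝓟 A) (𝓝 0) := by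
  -- A geometrically weighted sum over `k` handles the correlations with all orbit points at once,
  -- so one set of times serves every `k`.
  set c : ℕ → ℕ → ℝ := fun k n => (1 / 2 : ℝ) ^ k * ‖inner 𝕜 (U^[n] v) (U^[k] v)‖ ^ 2 with hc
  set D : ℝ := (‖v‖ * ‖v‖) ^ 2 with hD
  have hc0 : ∀ k n, 0 ≤ c k n := fun k n => by positivity
  have hcb : ∀ k n, c k n ≤ (1 / 2 : ℝ) ^ k * D := fun k n => by
    simp only [hc]
    grw [norm_inner_le_norm, norm_iterate, norm_iterate]
  have hgeom : Summable fun k : ℕ => (1 / 2 : ℝ) ^ k * D := summable_geometric_two.mul_right D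
  have hsum : ∀ n, Summable fun k => c k n := fun n =>
    Summable.of_nonneg_of_le (fun k => hc0 k n) (fun k => hcb k n) hgeom
  have hces : Tendsto (fun N : ℕ => (N : ℝ)⁻¹ * ∑ n ∈ Finset.range N, ∑' k, c k n)
      atTop (𝓝 0) := by
    have hlim : Tendsto (fun N : ℕ => ∑' k, (N : ℝ)⁻¹ * ∑ n ∈ Finset.range N, c k n)
        atTop (𝓝 (∑' _k : ℕ, (0 : ℝ))) := by
      refine tendsto_tsum_of_dominated_convergence hgeom (fun k => ?_)
        (Eventually.of_forall fun N k => ?_)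
      · have := (tendsto_cesaro_inner U hv (U^[k] v)).const_mul ((1 / 2 : ℝ) ^ k)
        rw [mul_zero] at this
        refine this.congr fun N => ?_
        rw [← Finset.mul_sum]
        ring
      · rw [Real.norm_of_nonneg
          (mul_nonneg (by positivity) (Finset.sum_nonneg fun n _ => hc0 k n))]
        rcases Nat.eq_zero_or_pos N with rfl | hN
        · simp only [CharP.cast_eq_zero, inv_zero, zero_mul]
          positivity
        have hN' : (0 : ℝ) < N := by exact_mod_cast hN
        rw [inv_mul_le_iff₀ hN']
        exact (Finset.sum_le_card_nsmul _ _ _ fun n _ => hcb k n).trans_eq (by simp)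
    rw [tsum_zero] at hlim
    refine hlim.congr fun N => ?_
    rw [tsum_mul_left, Summable.tsum_finsetSum fun n _ => hsum n]
  obtain ⟨A, hA, ha⟩ := exists_hasDensityOne_tendsto (fun n => tsum_nonneg fun k => hc0 k n) hces
  refine ⟨A, hA, fun w => ?_⟩
  set S := asymptoticOrthogonal 𝕜 (atTop ⊓ 𝓟 A) fun n => U^[n] v with hS
  have hScl : IsClosed (S : Set E) :=
    isClosed_asymptoticOrthogonal (C := ‖v‖) fun n => (norm_iterate U n v).le
  have horb : ∀ k, U^[k] v ∈ S := by
    intro k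
    change Tendsto (fun n => inner 𝕜 (U^[n] v) (U^[k] v)) (atTop ⊓ 𝓟 A) (𝓝 0)
    have h1 : Tendsto (fun n => c k n) (atTop ⊓ 𝓟 A) (𝓝 0) :=
      squeeze_zero (fun n => hc0 k n)
        (fun n => (hsum n).le_tsum k fun j _ => hc0 j n) ha
    have h2 : Tendsto (fun n => ‖inner 𝕜 (U^[n] v) (U^[k] v)‖ ^ 2) (atTop ⊓ 𝓟 A) (𝓝 0) := by
      have := h1.const_mul ((2 : ℝ) ^ k)
      rw [mul_zero] at this
      refine this.congr fun n => ?_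
      simp only [hc]
      rw [← mul_assoc, ← mul_pow]
      norm_num
    have h3 := h2.sqrt
    simp only [Real.sqrt_zero, Real.sqrt_sq (norm_nonneg _)] at h3
    exact tendsto_zero_iff_norm_tendsto_zero.2 h3
  have : CompleteSpace S := hScl.completeSpace_coe
  -- A vector orthogonal to `S` is orthogonal to the orbit, which lies in `S`; its correlations
  -- vanish identically, so it belongs to `S` too. Hence `S` is everything.
  have hw : w - S.starProjection w ∈ S := by
    change Tendsto (fun n => inner 𝕜 (U^[n] v) (w - S.starProjection w)) (atTop ⊓ 𝓟 A) (𝓝 0)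
    refine tendsto_const_nhds.congr fun n => ?_
    exact ((Submodule.mem_orthogonal _ _).1 (S.sub_starProjection_mem_orthogonal w) _
      (horb n)).symm
  have hw' : w ∈ S := by
    simpa using S.add_mem hw (S.starProjection_apply_mem w)
  exact hw'

theorem tendsto_norm_starProjection {l : Filter ℕ} {x : ℕ → E}
    (hx : ∀ w, Tendsto (fun n => inner 𝕜 (x n) w) l (𝓝 0)) (W : Submodule 𝕜 E)
    [FiniteDimensional 𝕜 W] : Tendsto (fun n => ‖W.starProjection (x n)‖) l (𝓝 0) := by
  have h : ∀ n, W.starProjection (x n) =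
      ∑ i, inner 𝕜 ((stdOrthonormalBasis 𝕜 W i : W) : E) (x n) •
        ((stdOrthonormalBasis 𝕜 W i : W) : E) := fun n => by
    simp [(stdOrthonormalBasis 𝕜 W).starProjection_eq_sum_rankOne]
  rw [← tendsto_zero_iff_norm_tendsto_zero]
  simp_rw [h]
  rw [← Finset.sum_const_zero (s := (Finset.univ : Finset (Fin (Module.finrank 𝕜 W))))]
  refine tendsto_finsetSum _ fun i _ => ?_
  have h1 := (RCLike.continuous_conj.tendsto _).comp (hx (stdOrthonormalBasis 𝕜 W i : W))
  simp only [Function.comp_def, inner_conj_symm, map_zero] at h1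
  simpa using h1.smul_const ((stdOrthonormalBasis 𝕜 W i : W) : E)

/-- The distance of an orbit to a finite-dimensional space is asymptotically bounded below by the
norm of a component of weakly vanishing orbit. -/
theorem eventually_lt_norm_sub_starProjection (U : E →ₗᵢ[𝕜] E) {l : Filter ℕ} {φ b : E}
    (hφb : inner 𝕜 (φ - b) b = 0)
    (hb : ∀ w, Tendsto (fun n => inner 𝕜 (U^[n] b) w) l (𝓝 0)) (W : Submodule 𝕜 E)
    [FiniteDimensional 𝕜 W] {η : ℝ} (hη : 0 < η) :
    ∀ᶠ n in l, ‖b‖ - η < ‖U^[n] φ - W.starProjection (U^[n] φ)‖ := by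
  rcases eq_or_ne b 0 with rfl | hb0
  · refine Eventually.of_forall fun n => lt_of_lt_of_le ?_ (norm_nonneg _)
    simpa using hη
  have hbpos : 0 < ‖b‖ := norm_pos_iff.2 hb0
  have h0 := (tendsto_norm_starProjection hb W).const_mul ‖φ‖
  rw [mul_zero] at h0
  filter_upwards [h0.eventually_lt_const (mul_pos hη hbpos)] with n hn
  have hiter : ∀ (k : ℕ) (x y : E), inner 𝕜 (U^[k] x) (U^[k] y) = inner 𝕜 x y := by
    intro k x y
    induction k with
    | zero => rfl
    | succ k ih => rw [Function.iterate_succ_apply', Function.iterate_succ_apply',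
        U.inner_map_map, ih]
  -- The residual is tested against `U^n b`: the pairing is `‖b‖²` up to a term that vanishes in the
  -- limit, and Cauchy–Schwarz with division by `‖b‖` gives the bound.
  have h1 : inner 𝕜 (U^[n] φ - W.starProjection (U^[n] φ)) (U^[n] b) =
      ((‖b‖ ^ 2 : ℝ) : 𝕜) - inner 𝕜 (U^[n] φ) (W.starProjection (U^[n] b)) := by
    rw [inner_sub_left, hiter, Submodule.inner_starProjection_left_eq_right]
    rw [inner_sub_left, sub_eq_zero] at hφb
    rw [hφb, inner_self_eq_norm_sq_to_K]
    norm_cast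
  have h2 : ‖b‖ ^ 2 ≤ ‖U^[n] φ - W.starProjection (U^[n] φ)‖ * ‖b‖ +
      ‖φ‖ * ‖W.starProjection (U^[n] b)‖ := by
    calc ‖b‖ ^ 2 = ‖((‖b‖ ^ 2 : ℝ) : 𝕜)‖ := by
          rw [RCLike.norm_ofReal, abs_of_nonneg (by positivity)]
      _ ≤ ‖inner 𝕜 (U^[n] φ - W.starProjection (U^[n] φ)) (U^[n] b)‖ +
          ‖inner 𝕜 (U^[n] φ) (W.starProjection (U^[n] b))‖ := by
          rw [sub_eq_iff_eq_add.1 h1.symm]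
          exact norm_add_le _ _
      _ ≤ _ := by
          grw [norm_inner_le_norm, norm_inner_le_norm]
          rw [norm_iterate, norm_iterate]
  nlinarith

/-- The distance of `φ` to the space `compactSubspace U`. -/
noncomputable def compactResidual [CompleteSpace E] (U : E →ₗᵢ[𝕜] E) (φ : E) : ℝ :=
  ‖φ - (compactSubspace U).starProjection φ‖

theorem _root_.Submodule.norm_sub_starProjection_le (W : Submodule 𝕜 E)
    [W.HasOrthogonalProjection] (x : E) {y : E} (hy : y ∈ W) :
    ‖x - W.starProjection x‖ ≤ ‖x - y‖ := by
  rw [W.starProjection_minimal]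
  exact ciInf_le ⟨0, by rintro _ ⟨z, rfl⟩; exact norm_nonneg _⟩ (⟨y, hy⟩ : W)

theorem compactResidual_le [CompleteSpace E] {U : E →ₗᵢ[𝕜] E} (φ : E) {F : Submodule 𝕜 E}
    (hF : IsFinInvariant U F) {ψ : E} (hψ : ψ ∈ F) : compactResidual U φ ≤ ‖φ - ψ‖ :=
  Submodule.norm_sub_starProjection_le _ _
    (Submodule.le_topologicalClosure _ (mem_finInvariantSpan.2 ⟨F, hF, hψ⟩))

theorem exists_norm_sub_lt [CompleteSpace E] (U : E →ₗᵢ[𝕜] E) (φ : E) {ε : ℝ} (hε : 0 < ε) :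
    ∃ F, IsFinInvariant U F ∧ ∃ ψ ∈ F, ‖φ - ψ‖ < compactResidual U φ + ε := by
  have h : (compactSubspace U).starProjection φ ∈ closure (finInvariantSpan U : Set E) :=
    (compactSubspace U).starProjection_apply_mem φ
  obtain ⟨ψ, ⟨F, hF, hψ⟩, hd⟩ := Metric.mem_closure_iff.1 h ε hε
  refine ⟨F, hF, ψ, hψ, ?_⟩
  rw [dist_eq_norm] at hd
  rw [compactResidual]
  grw [← hd]
  rw [← sub_add_sub_cancel φ ((compactSubspace U).starProjection φ) ψ]
  exact norm_add_le _ _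

/-- `T` need not be linear over a common field: it serves to pass between real and complex function
spaces. -/
theorem compactResidual_le_of_map {𝕜' E' : Type*} [RCLike 𝕜'] [NormedAddCommGroup E']
    [InnerProductSpace 𝕜' E'] [CompleteSpace E] [CompleteSpace E'] {U : E →ₗᵢ[𝕜] E}
    {U' : E' →ₗᵢ[𝕜'] E'} (T : E → E') (hT : ∀ x y, ‖T x - T y‖ ≤ ‖x - y‖)
    (hTF : ∀ F, IsFinInvariant U F → ∀ x ∈ F, ∃ F', IsFinInvariant U' F' ∧ T x ∈ F') (φ : E) :
    compactResidual U' (T φ) ≤ compactResidual U φ := by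
  refine le_of_forall_pos_le_add fun ε hε => ?_
  obtain ⟨F, hF, ψ, hψ, hlt⟩ := exists_norm_sub_lt U φ hε
  obtain ⟨F', hF', hψ'⟩ := hTF F hF ψ hψ
  exact (compactResidual_le _ hF' hψ').trans ((hT _ _).trans hlt.le)

/-- Orthogonal projection onto a finite-dimensional invariant subspace commutes with `U`. -/
theorem IsFinInvariant.norm_iterate_sub_starProjection {U : E →ₗᵢ[𝕜] E} {F : Submodule 𝕜 E}
    [F.HasOrthogonalProjection] (hF : IsFinInvariant U F) (φ : E) (n : ℕ) :
    ‖U^[n] φ - F.starProjection (U^[n] φ)‖ = ‖φ - F.starProjection φ‖ := by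
  induction n with
  | zero => rfl
  | succ n ih =>
    rw [Function.iterate_succ_apply', ← ih, ← U.norm_map (U^[n] φ - _), map_sub,
      Submodule.eq_starProjection_of_mem_orthogonal
        (hF.2 _ (F.starProjection_apply_mem (U^[n] φ)))]
    rw [← map_sub]
    exact hF.apply_mem_orthogonal (F.sub_starProjection_mem_orthogonal _)

/-- Over the complex numbers, the finite-dimensional invariant subspaces are spanned by
eigenvectors. -/
theorem topologicalClosure_span_eigenvectors {E : Type*} [NormedAddCommGroup E]
    [InnerProductSpace ℂ E] (U : E →ₗᵢ[ℂ] E) :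
    (Submodule.span ℂ {ψ : E | ∃ c : ℂ, Module.End.HasEigenvector U.toLinearMap c ψ}).topologicalClosure
      = compactSubspace U := by
  set S := Submodule.span ℂ {ψ : E | ∃ c : ℂ, Module.End.HasEigenvector U.toLinearMap c ψ}
  congr 1
  refine le_antisymm (Submodule.span_le.2 ?_) ?_
  · rintro ψ ⟨c, hψ⟩
    have h : U ψ = c • ψ := hψ.apply_eq_smul
    refine mem_finInvariantSpan.2 ⟨Submodule.span ℂ {ψ}, ⟨inferInstance, fun x hx => ?_⟩,
      Submodule.mem_span_singleton_self ψ⟩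
    obtain ⟨a, rfl⟩ := Submodule.mem_span_singleton.1 hx
    rw [map_smul, h]
    exact Submodule.smul_mem _ _ (Submodule.smul_mem _ _ (Submodule.mem_span_singleton_self ψ))
  · rintro x ⟨F, hF, hx⟩
    have := hF.1
    have hG : IsFinInvariant U (F ⊓ S) := by
      refine ⟨inferInstance, fun y hy => ⟨hF.2 y hy.1, ?_⟩⟩
      have hle : S ≤ S.comap U.toLinearMap := by
        refine Submodule.span_le.2 ?_
        rintro ψ ⟨c, hψ⟩
        change U ψ ∈ S
        have h : U ψ = c • ψ := hψ.apply_eq_smul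
        rw [h]
        exact S.smul_mem c (Submodule.subset_span ⟨c, hψ⟩)
      exact hle hy.2
    -- This complement is invariant, so if nonzero it contains an eigenvector, which also lies in `F
    -- ⊓ S` and is therefore orthogonal to itself.
    have hbot : F ⊓ (F ⊓ S)ᗮ = ⊥ := by
      by_contra hne
      have hnt : Nontrivial (F ⊓ (F ⊓ S)ᗮ : Submodule ℂ E) :=
        Submodule.nontrivial_iff_ne_bot.2 hne
      have hinv : ∀ y ∈ F ⊓ (F ⊓ S)ᗮ, U.toLinearMap y ∈ F ⊓ (F ⊓ S)ᗮ := fun y hy =>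
        ⟨hF.2 y hy.1, hG.apply_mem_orthogonal hy.2⟩
      obtain ⟨c, hc⟩ := Module.End.exists_eigenvalue (U.toLinearMap.restrict hinv)
      obtain ⟨y, hy⟩ := hc.exists_hasEigenvector
      have hye : Module.End.HasEigenvector U.toLinearMap c (y : E) := by
        refine ⟨Module.End.mem_eigenspace_iff.2 ?_, fun h => hy.2 (Subtype.ext h)⟩
        exact congrArg Subtype.val hy.apply_eq_smul
      have hyS : (y : E) ∈ S := Submodule.subset_span ⟨c, hye⟩
      have h0 : inner ℂ (y : E) (y : E) = 0 :=
        (Submodule.mem_orthogonal _ _).1 y.2.2 _ ⟨y.2.1, hyS⟩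
      exact hye.2 (inner_self_eq_zero.1 h0)
    have hxG : x - (F ⊓ S).starProjection x ∈ F ⊓ (F ⊓ S)ᗮ :=
      ⟨F.sub_mem hx ((F ⊓ S).starProjection_apply_mem x).1,
        (F ⊓ S).sub_starProjection_mem_orthogonal x⟩
    rw [hbot, Submodule.mem_bot, sub_eq_zero] at hxG
    rw [hxG]
    exact ((F ⊓ S).starProjection_apply_mem x).2

end Hilbert

/-! ### The Koopman isometry. -/

section Koopman

variable {M : Type*} [MeasurableSpace M] {μ : Measure M} {f : M → M}

/-- The Koopman operator as a linear isometry. -/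
noncomputable abbrev koopmanIsometry (𝕜 E : Type*) [RCLike 𝕜] [NormedAddCommGroup E]
    [NormedSpace 𝕜 E] (hf : MeasurePreserving f μ μ) : Lp E 2 μ →ₗᵢ[𝕜] Lp E 2 μ :=
  Lp.compMeasurePreservingₗᵢ 𝕜 f hf

theorem koopman_pow_apply (𝕜 E : Type*) [RCLike 𝕜] [NormedAddCommGroup E] [NormedSpace 𝕜 E]
    (hf : MeasurePreserving f μ μ) (n : ℕ) (x : Lp E 2 μ) :
    (koopman 𝕜 E hf ^ n) x = (koopmanIsometry 𝕜 E hf)^[n] x :=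
  Module.End.pow_apply _ _ _

theorem koopmanIsometry_iterate_toLp (𝕜 : Type*) {E : Type*} [RCLike 𝕜] [NormedAddCommGroup E]
    [NormedSpace 𝕜 E] (hf : MeasurePreserving f μ μ) (n : ℕ) {g : M → E} (hg : MemLp g 2 μ) :
    (koopmanIsometry 𝕜 E hf)^[n] (hg.toLp g) =
      (hg.comp_measurePreserving (hf.iterate n)).toLp (g ∘ f^[n]) := by
  change (Lp.compMeasurePreserving f hf)^[n] (hg.toLp g) = _
  rw [Lp.compMeasurePreserving_iterate, Lp.toLp_compMeasurePreserving]

theorem koopmanIsometry_coeFn (𝕜 : Type*) {E : Type*} [RCLike 𝕜] [NormedAddCommGroup E]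
    [NormedSpace 𝕜 E] (hf : MeasurePreserving f μ μ) (g : Lp E 2 μ) :
    koopmanIsometry 𝕜 E hf g =ᵐ[μ] g ∘ f :=
  Lp.coeFn_compMeasurePreserving g hf

/-- Pointwise linear maps commute with the Koopman operator. -/
theorem compLp_koopmanIsometry (𝕜 𝕜₁ 𝕜₂ : Type*) {E F : Type*} [RCLike 𝕜] [RCLike 𝕜₁] [RCLike 𝕜₂]
    [NormedAddCommGroup E] [NormedSpace 𝕜 E] [NormedSpace 𝕜₁ E] [NormedAddCommGroup F]
    [NormedSpace 𝕜 F] [NormedSpace 𝕜₂ F]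
    (hf : MeasurePreserving f μ μ) (T : E →L[𝕜] F) (g : Lp E 2 μ) :
    T.compLp (koopmanIsometry 𝕜₁ E hf g) = koopmanIsometry 𝕜₂ F hf (T.compLp g) := by
  apply Lp.ext
  filter_upwards [T.coeFn_compLp (koopmanIsometry 𝕜₁ E hf g), koopmanIsometry_coeFn 𝕜₁ hf g,
    koopmanIsometry_coeFn 𝕜₂ hf (T.compLp g),
    hf.quasiMeasurePreserving.ae (T.coeFn_compLp g)] with x h1 h2 h3 h4
  rw [h1, h2, h3, Function.comp_apply, Function.comp_apply, h4]

theorem koopmanIsometry_const (𝕜 : Type*) {E : Type*} [RCLike 𝕜] [NormedAddCommGroup E]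
    [NormedSpace 𝕜 E] [IsFiniteMeasure μ] (hf : MeasurePreserving f μ μ) (c : E) :
    koopmanIsometry 𝕜 E hf (Lp.const 2 μ c) = Lp.const 2 μ c := by
  rw [← MemLp.toLp_const]
  exact Lp.toLp_compMeasurePreserving _ hf

end Koopman

/-! ### Comparison of real and complex scalars. -/

section Scalars

variable {d : ℕ}

/-- The coordinatewise inclusion `ℝ^d → 𝕜^d` as a continuous linear map. -/
noncomputable def ofRealVecL (𝕜 : Type*) [RCLike 𝕜] (d : ℕ) :
    EuclideanSpace ℝ (Fin d) →L[ℝ] EuclideanSpace 𝕜 (Fin d) where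
  toFun := ofRealVec 𝕜
  map_add' x y := by ext i; simp [ofRealVec]
  map_smul' c x := by ext i; simp [ofRealVec, RCLike.real_smul_eq_coe_mul]
  cont := continuous_ofRealVec 𝕜

@[simp]
theorem ofRealVecL_apply (𝕜 : Type*) [RCLike 𝕜] (x : EuclideanSpace ℝ (Fin d)) :
    ofRealVecL 𝕜 d x = ofRealVec 𝕜 x := rfl

theorem norm_ofRealVec (𝕜 : Type*) [RCLike 𝕜] (x : EuclideanSpace ℝ (Fin d)) :
    ‖ofRealVec 𝕜 x‖ = ‖x‖ := by
  simp [EuclideanSpace.norm_eq, ofRealVec]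

/-- The coordinatewise real part `𝕜^d → ℝ^d`. -/
noncomputable def reVecL (𝕜 : Type*) [RCLike 𝕜] (d : ℕ) :
    EuclideanSpace 𝕜 (Fin d) →L[ℝ] EuclideanSpace ℝ (Fin d) where
  toFun x := WithLp.toLp 2 fun i => RCLike.re (x i)
  map_add' x y := by ext i; simp
  map_smul' c x := by ext i; simp [RCLike.smul_re]
  cont := (PiLp.continuous_toLp 2 _).comp (continuous_pi fun i =>
    RCLike.continuous_re.comp (PiLp.continuous_apply 2 _ i))

theorem norm_reVecL_le (𝕜 : Type*) [RCLike 𝕜] (x : EuclideanSpace 𝕜 (Fin d)) :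
    ‖reVecL 𝕜 d x‖ ≤ ‖x‖ := by
  rw [EuclideanSpace.norm_eq, EuclideanSpace.norm_eq]
  refine Real.sqrt_le_sqrt (Finset.sum_le_sum fun i _ => ?_)
  refine pow_le_pow_left₀ (norm_nonneg _) ?_ 2
  exact RCLike.norm_re_le_norm _

theorem reVecL_ofRealVec (𝕜 : Type*) [RCLike 𝕜] (x : EuclideanSpace ℝ (Fin d)) :
    reVecL 𝕜 d (ofRealVec 𝕜 x) = x := by
  ext i
  simp [reVecL, ofRealVec]

variable {M : Type*} [MeasurableSpace M] {μ : Measure M} {f : M → M}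

theorem norm_compLp_sub_le_of_norm_le {E F : Type*} [NormedAddCommGroup E] [NormedSpace ℝ E]
    [NormedAddCommGroup F] [NormedSpace ℝ F] (T : E →L[ℝ] F) (hT : ∀ x, ‖T x‖ ≤ ‖x‖)
    (x y : Lp E 2 μ) : ‖T.compLp x - T.compLp y‖ ≤ ‖x - y‖ := by
  have h : T.compLp x - T.compLp y = T.compLp (x - y) :=
    (map_sub (T.compLpL 2 μ) x y).symm
  rw [h]
  grw [T.norm_compLp_le, T.opNorm_le_bound zero_le_one fun z => by simpa using hT z, one_mul]

/-- The distance of a real function to the compact part does not depend on the scalars. -/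
theorem compactResidual_ofReal (𝕜 : Type*) [RCLike 𝕜] (hf : MeasurePreserving f μ μ)
    (ψ : Lp (EuclideanSpace ℝ (Fin d)) 2 μ) :
    compactResidual (koopmanIsometry 𝕜 (EuclideanSpace 𝕜 (Fin d)) hf)
      ((ofRealVecL 𝕜 d).compLp ψ) =
    compactResidual (koopmanIsometry ℝ (EuclideanSpace ℝ (Fin d)) hf) ψ := by
  -- Inclusion and real part are both norm-nonincreasing and commute with `U`; each gives one
  -- inequality.
  refine le_antisymm ?_ ?_
  · refine compactResidual_le_of_map (ofRealVecL 𝕜 d).compLp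
      (norm_compLp_sub_le_of_norm_le _ fun x => (norm_ofRealVec 𝕜 x).le) ?_ ψ
    intro F hF x hx
    have := hF.1
    set T := (ofRealVecL 𝕜 d).compLpL 2 μ with hT
    refine ⟨Submodule.span 𝕜 (T '' F), ⟨?_, ?_⟩, Submodule.subset_span ⟨x, hx, rfl⟩⟩
    · obtain ⟨s, hs⟩ := Module.Finite.iff_fg.1 hF.1
      have hle : Submodule.span 𝕜 (T '' F) ≤ Submodule.span 𝕜 (T '' (s : Set _)) := by
        refine Submodule.span_le.2 ?_
        rintro _ ⟨y, hy, rfl⟩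
        have hy' : T y ∈ (Submodule.span ℝ (s : Set _)).map T.toLinearMap :=
          ⟨y, by rw [hs]; exact hy, rfl⟩
        rw [Submodule.map_span] at hy'
        exact Submodule.span_subset_span ℝ 𝕜 _ hy'
      have := FiniteDimensional.span_of_finite 𝕜 (s.finite_toSet.image T)
      exact Submodule.finiteDimensional_of_le hle
    · intro y hy
      induction hy using Submodule.span_induction with
      | mem y hy =>
        obtain ⟨z, hz, rfl⟩ := hy
        refine Submodule.subset_span ⟨_, hF.2 z hz, ?_⟩
        exact compLp_koopmanIsometry ℝ ℝ 𝕜 hf (ofRealVecL 𝕜 d) z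
      | zero => simp
      | add a b _ _ ha hb => rw [map_add]; exact Submodule.add_mem _ ha hb
      | smul c a _ ha => rw [map_smul]; exact Submodule.smul_mem _ c ha
  · have h : (reVecL 𝕜 d).compLp ((ofRealVecL 𝕜 d).compLp ψ) = ψ := by
      apply Lp.ext
      filter_upwards [(reVecL 𝕜 d).coeFn_compLp ((ofRealVecL 𝕜 d).compLp ψ),
        (ofRealVecL 𝕜 d).coeFn_compLp ψ] with x h1 h2
      rw [h1, h2, ofRealVecL_apply, reVecL_ofRealVec]
    conv_lhs => rw [← h]
    refine compactResidual_le_of_map (reVecL 𝕜 d).compLp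
      (norm_compLp_sub_le_of_norm_le _ fun x => norm_reVecL_le 𝕜 x) ?_ _
    intro F hF x hx
    have := hF.1
    set T := (reVecL 𝕜 d).compLpL 2 μ with hT
    refine ⟨(F.restrictScalars ℝ).map T.toLinearMap, ⟨?_, ?_⟩, ⟨x, hx, rfl⟩⟩
    · have h1 : FiniteDimensional ℝ F := FiniteDimensional.trans ℝ 𝕜 F
      have h2 : FiniteDimensional ℝ (F.restrictScalars ℝ) := h1
      infer_instance
    · rintro _ ⟨z, hz, rfl⟩
      refine ⟨_, hF.2 z hz, ?_⟩
      exact compLp_koopmanIsometry ℝ 𝕜 ℝ hf (reVecL 𝕜 d) z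

end Scalars

/-! ### Constant functions and the mean. -/

section Constants

variable {M : Type*} [MeasurableSpace M] {μ : Measure M} [IsProbabilityMeasure μ] {f : M → M}
  {𝕜 E : Type*} [RCLike 𝕜] [NormedAddCommGroup E] [InnerProductSpace 𝕜 E]

/-- The space of constant functions. -/
noncomputable def constSubspace (μ : Measure M) [IsFiniteMeasure μ] (𝕜 E : Type*) [RCLike 𝕜]
    [NormedAddCommGroup E] [NormedSpace 𝕜 E] : Submodule 𝕜 (Lp E 2 μ) :=
  LinearMap.range (Lp.constₗ 2 μ 𝕜 : E →ₗ[𝕜] Lp E 2 μ)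

theorem const_mem_constSubspace (c : E) : Lp.const 2 μ c ∈ constSubspace μ 𝕜 E := ⟨c, rfl⟩

theorem isFinInvariant_constSubspace [FiniteDimensional 𝕜 E] (hf : MeasurePreserving f μ μ) :
    IsFinInvariant (koopmanIsometry 𝕜 E hf) (constSubspace μ 𝕜 E) := by
  refine ⟨by unfold constSubspace; infer_instance, ?_⟩
  rintro _ ⟨c, rfl⟩
  exact ⟨c, (koopmanIsometry_const 𝕜 hf c).symm⟩

theorem integrable_coeFn_Lp (g : Lp E 2 μ) : Integrable g μ :=
  (Lp.memLp g).integrable one_le_two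

theorem inner_const_left [NormedSpace ℝ E] [CompleteSpace E] (c : E) (g : Lp E 2 μ) :
    inner 𝕜 (Lp.const 2 μ c) g = inner 𝕜 c (∫ x, g x ∂μ) := by
  rw [L2.inner_def, ← integral_inner (integrable_coeFn_Lp g)]
  refine integral_congr_ae ?_
  filter_upwards [Lp.coeFn_const (p := 2) (μ := μ) (c := c)] with x hx
  rw [hx]
  rfl

theorem starProjection_constSubspace [NormedSpace ℝ E] [FiniteDimensional 𝕜 E]
    [CompleteSpace E] [(constSubspace μ 𝕜 E).HasOrthogonalProjection] (g : Lp E 2 μ) :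
    (constSubspace μ 𝕜 E).starProjection g = Lp.const 2 μ (∫ x, g x ∂μ) := by
  refine Submodule.eq_starProjection_of_mem_of_inner_eq_zero (const_mem_constSubspace _) ?_
  rintro _ ⟨c, rfl⟩
  rw [inner_eq_zero_symm, inner_sub_right, sub_eq_zero]
  change inner 𝕜 (Lp.const 2 μ c) g = inner 𝕜 (Lp.const 2 μ c) _
  rw [inner_const_left, inner_const_left]
  congr 1
  rw [integral_congr_ae (Lp.coeFn_const (p := 2) (μ := μ) (c := ∫ x, g x ∂μ))]
  simp

end Constants

/-! ### The measurement in `L²`. -/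

section Observable

variable {M : Type*} [TopologicalSpace M] [SecondCountableTopology M] [MeasurableSpace M]
  [BorelSpace M] {μ : Measure M} [IsProbabilityMeasure μ] {d : ℕ} {f : M → M}

theorem obsL2_eq_compLp (𝕜 : Type*) [RCLike 𝕜] (hμ : IsCompact μ.support)
    {φ : M → EuclideanSpace ℝ (Fin d)} (hφ : Continuous φ) :
    obsL2 𝕜 hμ hφ = (ofRealVecL 𝕜 d).compLp ((memLp_of_isCompact_support hμ hφ).toLp φ) := by
  apply Lp.ext
  filter_upwards [(ofRealVecL 𝕜 d).coeFn_compLp ((memLp_of_isCompact_support hμ hφ).toLp φ),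
    (memLp_of_isCompact_support hμ hφ).coeFn_toLp,
    (memLp_of_isCompact_support hμ ((continuous_ofRealVec 𝕜).comp hφ)).coeFn_toLp] with x h1 h2 h3
  rw [h1, h2, obsL2, h3]
  rfl

/-- The residual is defined over `ℂ`, the hypothesis spaces live over `𝕜`; both residuals equal the
real one. -/
theorem mixingResidual_eq_compactResidual (𝕜 : Type*) [RCLike 𝕜] (hμ : IsCompact μ.support)
    {φ : M → EuclideanSpace ℝ (Fin d)} (hφ : Continuous φ) (hf : MeasurePreserving f μ μ) :
    mixingResidual hμ hφ hf =
      compactResidual (koopmanIsometry 𝕜 (EuclideanSpace 𝕜 (Fin d)) hf) (obsL2 𝕜 hμ hφ) := by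
  have h : mixingResidual hμ hφ hf =
      compactResidual (koopmanIsometry ℂ (EuclideanSpace ℂ (Fin d)) hf) (obsL2 ℂ hμ hφ) := by
    rw [mixingResidual, compactResidual]
    congr! 4
    exact topologicalClosure_span_eigenvectors (koopmanIsometry ℂ (EuclideanSpace ℂ (Fin d)) hf)
  rw [h, obsL2_eq_compLp, obsL2_eq_compLp, compactResidual_ofReal, compactResidual_ofReal]

theorem norm_obsL2_sub_const (𝕜 : Type*) [RCLike 𝕜] (hμ : IsCompact μ.support)
    {φ : M → EuclideanSpace ℝ (Fin d)} (hφ : Continuous φ) :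
    ‖obsL2 𝕜 hμ hφ - Lp.const 2 μ (ofRealVec 𝕜 (∫ x, φ x ∂μ))‖ = stdDev μ φ := by
  rw [Lp.norm_def, stdDev]
  congr 1
  refine eLpNorm_congr_norm_ae ?_
  filter_upwards [Lp.coeFn_sub (obsL2 𝕜 hμ hφ) (Lp.const 2 μ (ofRealVec 𝕜 (∫ x, φ x ∂μ))),
    Lp.coeFn_const (p := 2) (μ := μ) (c := ofRealVec 𝕜 (∫ x, φ x ∂μ)),
    (memLp_of_isCompact_support hμ ((continuous_ofRealVec 𝕜).comp hφ)).coeFn_toLp] with x h1 h2 h3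
  rw [h1, Pi.sub_apply, h2, obsL2, h3, ← norm_ofRealVec 𝕜]
  exact congrArg norm (map_sub (ofRealVecL 𝕜 d) _ _).symm

theorem integral_obsL2 (𝕜 : Type*) [RCLike 𝕜] (hμ : IsCompact μ.support)
    {φ : M → EuclideanSpace ℝ (Fin d)} (hφ : Continuous φ) :
    ∫ x, obsL2 𝕜 hμ hφ x ∂μ = ofRealVec 𝕜 (∫ x, φ x ∂μ) := by
  rw [obsL2, integral_congr_ae (MemLp.coeFn_toLp _)]
  exact (ofRealVecL 𝕜 d).integral_comp_comm
    ((memLp_of_isCompact_support hμ hφ).integrable one_le_two)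

end Observable

/-! ### Strong and weak mixing. -/

section Mixing

variable {M : Type*} [MeasurableSpace M] {μ : Measure M} [IsProbabilityMeasure μ] {f : M → M}

/-- A closed subspace of `L²` that contains all indicator functions is everything. -/
theorem eq_top_of_indicatorConstLp_mem {𝕜 E : Type*} [RCLike 𝕜] [NormedAddCommGroup E]
    [NormedSpace 𝕜 E] {S : Submodule 𝕜 (Lp E 2 μ)} (hS : IsClosed (S : Set (Lp E 2 μ)))
    (h : ∀ (A : Set M) (hA : MeasurableSet A) (c : E),
      indicatorConstLp 2 hA (measure_ne_top μ A) c ∈ S) : S = ⊤ := by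
  refine eq_top_iff.2 fun x _ => ?_
  refine Lp.induction (by norm_num) (motive := fun x => x ∈ S) (fun c A hA hAμ => ?_)
    (fun g k hg hk _ hgS hkS => S.add_mem hgS hkS) hS x
  rw [Lp.simpleFunc.coe_indicatorConst]
  exact h A hA c

/-- For a strongly mixing map, the iterates of a function of zero mean converge weakly to zero. -/
theorem IsStronglyMixing.tendsto_inner {𝕜 E : Type*} [RCLike 𝕜] [NormedAddCommGroup E]
    [InnerProductSpace 𝕜 E] [NormedSpace ℝ E] [IsScalarTower ℝ 𝕜 E] [FiniteDimensional 𝕜 E]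
    [CompleteSpace E] (hmix : IsStronglyMixing μ f) (hf : MeasurePreserving f μ μ) {y : Lp E 2 μ}
    (hy : y ∈ (constSubspace μ 𝕜 E)ᗮ) (x : Lp E 2 μ) :
    Tendsto (fun n => inner 𝕜 ((koopmanIsometry 𝕜 E hf)^[n] y) x) atTop (𝓝 0) := by
  set U := koopmanIsometry 𝕜 E hf
  have : FiniteDimensional 𝕜 (constSubspace μ 𝕜 E) := (isFinInvariant_constSubspace hf).1
  set P := (constSubspace μ 𝕜 E).starProjection with hP
  -- Mixing says that `R n = U^n - P` tends weakly to zero between indicators. As the `R n` are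
  -- uniformly bounded, this extends to all of `L²` in the second argument and then, through the
  -- adjoints, in the first.
  let R : ℕ → Lp E 2 μ →L[𝕜] Lp E 2 μ := fun n => U.toContinuousLinearMap ^ n - P
  have hR : ∀ n z, R n z = U^[n] z - P z := fun n z => by
    rw [← U.coe_toContinuousLinearMap, ← FunLike.coe_pow_eq_iterate]
    rfl
  have hRn : ∀ n z, ‖R n z‖ ≤ 2 * ‖z‖ := fun n z => by
    rw [hR]
    grw [norm_sub_le, norm_iterate, Submodule.norm_starProjection_apply_le]
    linarith
  have hind : ∀ (A : Set M) (hA : MeasurableSet A) (B : Set M) (hB : MeasurableSet B) (a b : E),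
      Tendsto (fun n => inner 𝕜 (R n (indicatorConstLp 2 hB (measure_ne_top μ B) b))
        (indicatorConstLp 2 hA (measure_ne_top μ A) a)) atTop (𝓝 0) := by
    intro A hA B hB a b
    have hlim : Tendsto (fun n : ℕ => μ.real (f^[n] ⁻¹' B ∩ A)) atTop
        (𝓝 (μ.real A * μ.real B)) := by
      have h := (ENNReal.tendsto_toReal (ENNReal.mul_ne_top (measure_ne_top μ A)
        (measure_ne_top μ B))).comp (hmix A B hA hB)
      rw [ENNReal.toReal_mul] at h
      refine h.congr fun n => ?_
      rw [Set.inter_comm]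
      rfl
    have hval : ∀ n, inner 𝕜 (R n (indicatorConstLp 2 hB (measure_ne_top μ B) b))
        (indicatorConstLp 2 hA (measure_ne_top μ A) a) =
        ((μ.real (f^[n] ⁻¹' B ∩ A) - μ.real A * μ.real B : ℝ) : 𝕜) * inner 𝕜 b a := by
      intro n
      have h1 : U^[n] (indicatorConstLp 2 hB (measure_ne_top μ B) b) =
          indicatorConstLp 2 ((hf.iterate n).measurable hB) (measure_ne_top μ _) b := by
        change (Lp.compMeasurePreserving f hf)^[n] _ = _
        rw [Lp.compMeasurePreserving_iterate, Lp.indicatorConstLp_compMeasurePreserving]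
      have h2 : P (indicatorConstLp 2 hB (measure_ne_top μ B) b) =
          indicatorConstLp 2 MeasurableSet.univ (measure_ne_top μ _) (μ.real B • b) := by
        rw [hP, starProjection_constSubspace, ← indicatorConstLp_univ]
        congr 1
        rw [integral_congr_ae indicatorConstLp_coeFn, integral_indicator_const _ hB]
      rw [hR, h1, h2, inner_sub_left, L2.inner_indicatorConstLp_indicatorConstLp,
        L2.inner_indicatorConstLp_indicatorConstLp]
      rw [inner_smul_left_eq_smul, Set.univ_inter, smul_smul, ← sub_smul, Algebra.smul_def]
    simp_rw [hval]
    have h0 : Tendsto (fun n : ℕ => μ.real (f^[n] ⁻¹' B ∩ A) - μ.real A * μ.real B) atTop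
        (𝓝 0) := by
      simpa using hlim.sub_const (μ.real A * μ.real B)
    simpa using ((RCLike.continuous_ofReal (K := 𝕜)).tendsto 0 |>.comp h0).mul_const (inner 𝕜 b a)
  have hxall : ∀ (B : Set M) (hB : MeasurableSet B) (b : E) (z : Lp E 2 μ),
      Tendsto (fun n => inner 𝕜 (R n (indicatorConstLp 2 hB (measure_ne_top μ B) b)) z)
        atTop (𝓝 0) := by
    intro B hB b z
    have h := eq_top_of_indicatorConstLp_mem (𝕜 := 𝕜)
      (isClosed_asymptoticOrthogonal (l := atTop) fun n =>
        hRn n (indicatorConstLp 2 hB (measure_ne_top μ B) b))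
      fun A hA a => hind A hA B hB a b
    exact (h.symm ▸ Submodule.mem_top : z ∈ asymptoticOrthogonal 𝕜 atTop _)
  have hadj : ∀ n, ‖(R n).adjoint x‖ ≤ 2 * ‖x‖ := fun n => by
    grw [ContinuousLinearMap.le_opNorm, LinearIsometryEquiv.norm_map,
      (R n).opNorm_le_bound zero_le_two (hRn n)]
  have h := eq_top_of_indicatorConstLp_mem (𝕜 := 𝕜)
    (isClosed_asymptoticOrthogonal (l := atTop) hadj) fun B hB b => by
      change Tendsto (fun n => inner 𝕜 ((R n).adjoint x)
        (indicatorConstLp 2 hB (measure_ne_top μ B) b)) atTop (𝓝 0)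
      simp_rw [ContinuousLinearMap.adjoint_inner_left]
      have h1 := (RCLike.continuous_conj.tendsto _).comp (hxall B hB b x)
      simpa only [Function.comp_def, inner_conj_symm, map_zero] using h1
  have hy' : Tendsto (fun n => inner 𝕜 ((R n).adjoint x) y) atTop (𝓝 0) :=
    (h.symm ▸ Submodule.mem_top : y ∈ asymptoticOrthogonal 𝕜 atTop _)
  have hPy : P y = 0 := (Submodule.starProjection_apply_eq_zero_iff _).2 hy
  have h1 := (RCLike.continuous_conj.tendsto _).comp hy'
  simpa only [Function.comp_def, ContinuousLinearMap.adjoint_inner_left, hR, hPy, sub_zero,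
    inner_conj_symm, map_zero] using h1

theorem constSubspace_le_discreteSubspace (hf : MeasurePreserving f μ μ) (E : Type*)
    [NormedAddCommGroup E] [InnerProductSpace ℂ E] [FiniteDimensional ℂ E] :
    constSubspace μ ℂ E ≤ discreteSubspace E hf := by
  have h : discreteSubspace E hf = compactSubspace (koopmanIsometry ℂ E hf) :=
    topologicalClosure_span_eigenvectors (koopmanIsometry ℂ E hf)
  rw [h]
  exact fun x hx => Submodule.le_topologicalClosure _
    (mem_finInvariantSpan.2 ⟨_, isFinInvariant_constSubspace hf, hx⟩)

theorem constSubspace_scalar : constSubspace μ ℂ ℂ = Submodule.span ℂ {Lp.const 2 μ (1 : ℂ)} := by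
  ext x
  rw [Submodule.mem_span_singleton]
  constructor
  · rintro ⟨c, rfl⟩
    exact ⟨c, by simpa using (map_smul (Lp.constₗ 2 μ ℂ : ℂ →ₗ[ℂ] Lp ℂ 2 μ) c (1 : ℂ)).symm⟩
  · rintro ⟨c, rfl⟩
    exact (constSubspace μ ℂ ℂ).smul_mem c (const_mem_constSubspace _)

/-- If the only eigenfunctions are constant, so is the space they span. -/
theorem discreteSubspace_eq_constSubspace (hf : MeasurePreserving f μ μ) (E : Type*)
    [NormedAddCommGroup E] [InnerProductSpace ℂ E] [FiniteDimensional ℂ E]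
    (h : ∀ (c : ℂ) (ψ : Lp E 2 μ), koopmanIsometry ℂ E hf ψ = c • ψ → ψ ∈ constSubspace μ ℂ E) :
    discreteSubspace E hf = constSubspace μ ℂ E := by
  have : FiniteDimensional ℂ (constSubspace μ ℂ E) := (isFinInvariant_constSubspace hf).1
  refine le_antisymm ?_ (constSubspace_le_discreteSubspace hf E)
  refine Submodule.topologicalClosure_minimal _ (Submodule.span_le.2 ?_)
    (constSubspace μ ℂ E).closed_of_finiteDimensional
  rintro ψ ⟨c, hψ⟩
  exact h c ψ hψ.apply_eq_smul

/-- An eigenfunction minus its mean is zero or an eigenfunction with `‖c‖ = 1`; its autocorrelations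
then have constant modulus, yet tend to zero. -/
theorem IsStronglyMixing.isWeaklyMixing (hmix : IsStronglyMixing μ f)
    (hf : MeasurePreserving f μ μ) : IsWeaklyMixing hf := by
  rw [IsWeaklyMixing, ← constSubspace_scalar]
  refine discreteSubspace_eq_constSubspace hf ℂ fun c ψ hψ => ?_
  have : FiniteDimensional ℂ (constSubspace μ ℂ ℂ) := (isFinInvariant_constSubspace hf).1
  set U := koopmanIsometry ℂ ℂ hf
  set P := (constSubspace μ ℂ ℂ).starProjection with hP
  have hPmem : P ψ ∈ constSubspace μ ℂ ℂ := Submodule.starProjection_apply_mem _ _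
  have hPo : ψ - P ψ ∈ (constSubspace μ ℂ ℂ)ᗮ := Submodule.sub_starProjection_mem_orthogonal _
  have hUP : U (P ψ) = P ψ := by
    obtain ⟨a, ha⟩ := hPmem
    rw [← ha]
    exact koopmanIsometry_const ℂ hf a
  have hcP : c • P ψ = P ψ := by
    rw [← map_smul, ← hψ]
    refine Submodule.eq_starProjection_of_mem_orthogonal hPmem ?_
    have h1 := (isFinInvariant_constSubspace hf).apply_mem_orthogonal hPo
    rwa [map_sub, hUP] at h1
  have hU : U (ψ - P ψ) = c • (ψ - P ψ) := by rw [map_sub, hUP, hψ, smul_sub, hcP]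
  have hiter : ∀ n, U^[n] (ψ - P ψ) = c ^ n • (ψ - P ψ) := by
    intro n
    induction n with
    | zero => simp
    | succ n ih => rw [Function.iterate_succ_apply', ih, map_smul, hU, smul_smul, pow_succ]
  by_cases h0 : ψ - P ψ = 0
  · rw [sub_eq_zero.1 h0]
    exact hPmem
  have hn0 : ‖ψ - P ψ‖ ≠ 0 := norm_ne_zero_iff.2 h0
  have hc : ‖c‖ = 1 := by
    have h1 := U.norm_map (ψ - P ψ)
    rw [hU, norm_smul] at h1
    exact mul_right_cancel₀ hn0 (h1.trans (one_mul _).symm)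
  have hlim := (hmix.tendsto_inner hf hPo (ψ - P ψ)).norm
  have hconst : ∀ n, ‖inner ℂ (U^[n] (ψ - P ψ)) (ψ - P ψ)‖ = ‖ψ - P ψ‖ ^ 2 := fun n => by
    rw [hiter, inner_smul_left, norm_mul, RCLike.norm_conj, norm_pow, hc, one_pow, one_mul,
      inner_self_eq_norm_sq_to_K]
    simp
  have h2 := tendsto_nhds_unique (tendsto_const_nhds.congr fun n => (hconst n).symm) hlim
  rw [norm_zero] at h2
  exact absurd (pow_eq_zero_iff two_ne_zero |>.1 h2) hn0

variable {d : ℕ}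

/-- The coordinate functionals of `ℂ^d`. -/
noncomputable def coordL (i : Fin d) : EuclideanSpace ℂ (Fin d) →L[ℂ] ℂ :=
  EuclideanSpace.proj i

/-- For a weakly mixing map, `𝒟` consists of the constants for vector valued functions as well. -/
theorem IsWeaklyMixing.discreteSubspace_eq {hf : MeasurePreserving f μ μ}
    (h : IsWeaklyMixing hf) :
    discreteSubspace (EuclideanSpace ℂ (Fin d)) hf =
      constSubspace μ ℂ (EuclideanSpace ℂ (Fin d)) := by
  refine discreteSubspace_eq_constSubspace hf _ fun c ψ hψ => ?_
  have hcomp : ∀ i : Fin d, ∃ a : ℂ,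
      (coordL i).compLp ψ = Lp.const 2 μ a := by
    intro i
    set T : EuclideanSpace ℂ (Fin d) →L[ℂ] ℂ := coordL i with hT
    -- A coordinate of an eigenfunction is zero or a scalar eigenfunction for the same eigenvalue.
    have hmem : T.compLp ψ ∈ discreteSubspace ℂ hf := by
      by_cases h0 : T.compLp ψ = 0
      · rw [h0]
        exact Submodule.zero_mem _
      refine Submodule.le_topologicalClosure _ (Submodule.subset_span ⟨c, ?_, h0⟩)
      rw [Module.End.mem_genEigenspace_one]
      change koopmanIsometry ℂ ℂ hf (T.compLp ψ) = _
      rw [← compLp_koopmanIsometry ℂ ℂ ℂ, hψ]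
      exact map_smul (T.compLpL 2 μ) c ψ
    rw [IsWeaklyMixing] at h
    rw [h, ← constSubspace_scalar] at hmem
    obtain ⟨a, ha⟩ := hmem
    exact ⟨a, ha.symm⟩
  choose a ha using hcomp
  refine ⟨WithLp.toLp 2 a, ?_⟩
  apply Lp.ext
  have hae : ∀ᵐ x ∂μ, ∀ i : Fin d, ψ x i = a i := by
    rw [ae_all_iff]
    intro i
    filter_upwards [(coordL i).coeFn_compLp ψ,
      Lp.coeFn_const (p := 2) (μ := μ) (c := a i)] with x h1 h2
    rw [ha i, h2] at h1
    exact h1.symm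
  filter_upwards [hae, Lp.coeFn_const (p := 2) (μ := μ)
    (c := (WithLp.toLp 2 a : EuclideanSpace ℂ (Fin d)))] with x h1 h2
  change Lp.const 2 μ (WithLp.toLp 2 a : EuclideanSpace ℂ (Fin d)) x = _
  rw [h2]
  ext i
  exact (h1 i).symm

end Mixing

/-! ### Purely discrete spectrum. -/

section DiscreteSpectrum

variable {M : Type*} [MeasurableSpace M] {μ : Measure M} {f : M → M} {d : ℕ}

/-- For purely discrete spectrum, `𝒟` contains all vector valued functions as well. -/
theorem HasPurelyDiscreteSpectrum.discreteSubspace_eq {hf : MeasurePreserving f μ μ}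
    (h : HasPurelyDiscreteSpectrum hf) :
    discreteSubspace (EuclideanSpace ℂ (Fin d)) hf = ⊤ := by
  refine eq_top_iff.2 fun ψ _ => ?_
  let J : Fin d → ℂ →L[ℂ] EuclideanSpace ℂ (Fin d) := fun i =>
    ContinuousLinearMap.toSpanSingleton ℂ (EuclideanSpace.single i (1 : ℂ))
  have hJ : ∀ i (g : Lp ℂ 2 μ), (J i).compLp g ∈
      discreteSubspace (EuclideanSpace ℂ (Fin d)) hf := by
    intro i g
    have hg : g ∈ discreteSubspace ℂ hf := by
      rw [HasPurelyDiscreteSpectrum] at h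
      rw [h]
      exact Submodule.mem_top
    have hle : discreteSubspace ℂ hf ≤
        (discreteSubspace (EuclideanSpace ℂ (Fin d)) hf).comap
          ((J i).compLpL 2 μ).toLinearMap := by
      refine Submodule.topologicalClosure_minimal _ (Submodule.span_le.2 ?_) ?_
      · rintro k ⟨c, hk⟩
        change (J i).compLp k ∈ discreteSubspace (EuclideanSpace ℂ (Fin d)) hf
        by_cases h0 : (J i).compLp k = 0
        · rw [h0]
          exact Submodule.zero_mem _
        refine Submodule.le_topologicalClosure _ (Submodule.subset_span ⟨c, ?_, h0⟩)
        rw [Module.End.mem_genEigenspace_one]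
        change koopmanIsometry ℂ _ hf ((J i).compLp k) = _
        have hk' : koopmanIsometry ℂ ℂ hf k = c • k := hk.apply_eq_smul
        rw [← compLp_koopmanIsometry ℂ ℂ ℂ, hk']
        exact map_smul ((J i).compLpL 2 μ) c k
      · exact (Submodule.isClosed_topologicalClosure _).preimage ((J i).compLpL 2 μ).continuous
    exact hle hg
  have hsum : ψ = ∑ i, (J i).compLp
      ((coordL i).compLp ψ) := by
    apply Lp.ext
    have hae : ∀ᵐ x ∂μ, ∀ i : Fin d, (J i).compLp
        ((coordL i).compLp ψ) x =
        J i (ψ x i) := by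
      rw [ae_all_iff]
      intro i
      filter_upwards [(J i).coeFn_compLp
        ((coordL i).compLp ψ),
        (coordL i).coeFn_compLp ψ] with x h1 h2
      rw [h1, h2]
      rfl
    filter_upwards [hae, Lp.coeFn_finsetSum Finset.univ fun i : Fin d => (J i).compLp
      ((coordL i).compLp ψ)] with x h1 h2
    rw [h2, Finset.sum_apply, Finset.sum_congr rfl fun i _ => h1 i]
    ext j
    simp [J, ContinuousLinearMap.toSpanSingleton_apply, Pi.single_apply]
  rw [hsum]
  exact Submodule.sum_mem _ fun i _ => hJ i _

end DiscreteSpectrum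

section Observable

variable {M : Type*} [TopologicalSpace M] [SecondCountableTopology M] [MeasurableSpace M]
  [BorelSpace M] {μ : Measure M} [IsProbabilityMeasure μ] {d : ℕ} {f : M → M}

theorem IsWeaklyMixing.mixingResidual_eq_stdDev {hf : MeasurePreserving f μ μ}
    (h : IsWeaklyMixing hf) (hμ : IsCompact μ.support) {φ : M → EuclideanSpace ℝ (Fin d)}
    (hφ : Continuous φ) : mixingResidual hμ hφ hf = stdDev μ φ := by
  have : FiniteDimensional ℂ (constSubspace μ ℂ (EuclideanSpace ℂ (Fin d))) :=
    (isFinInvariant_constSubspace hf).1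
  have h1 : (discreteSubspace (EuclideanSpace ℂ (Fin d)) hf).starProjection (obsL2 ℂ hμ hφ) =
      (constSubspace μ ℂ (EuclideanSpace ℂ (Fin d))).starProjection (obsL2 ℂ hμ hφ) := by
    congr! 2
    exact h.discreteSubspace_eq
  rw [mixingResidual, h1, starProjection_constSubspace, integral_obsL2, norm_obsL2_sub_const]

theorem HasPurelyDiscreteSpectrum.mixingResidual_eq_zero {hf : MeasurePreserving f μ μ}
    (h : HasPurelyDiscreteSpectrum hf) (hμ : IsCompact μ.support)
    {φ : M → EuclideanSpace ℝ (Fin d)} (hφ : Continuous φ) : mixingResidual hμ hφ hf = 0 := by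
  rw [mixingResidual, Submodule.starProjection_eq_self_iff.2, sub_self, norm_zero]
  rw [h.discreteSubspace_eq]
  exact Submodule.mem_top

end Observable

/-! ### Hypothesis spaces and closest approximations. -/

section Hypothesis

variable {M : Type*} [MeasurableSpace M] {𝕜 : Type*} [RCLike 𝕜] {d L : ℕ} {μ : Measure M}

/-- The functions `h` for which `h ∘ Φ` is a version of a member of the subspace `F` of `L²`. -/
def pullbackClass (Φ : M → EuclideanSpace ℝ (Fin L))
    (F : Submodule 𝕜 (Lp (EuclideanSpace 𝕜 (Fin d)) 2 μ)) :
    Submodule 𝕜 (EuclideanSpace ℝ (Fin L) → EuclideanSpace 𝕜 (Fin d)) where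
  carrier := {h | ∃ ψ ∈ F, ψ =ᵐ[μ] fun ω => h (Φ ω)}
  zero_mem' := ⟨0, F.zero_mem, Lp.coeFn_zero _ _ _⟩
  add_mem' := by
    rintro h k ⟨a, haF, ha⟩ ⟨b, hbF, hb⟩
    refine ⟨a + b, F.add_mem haF hbF, (Lp.coeFn_add a b).trans ?_⟩
    filter_upwards [ha, hb] with ω h1 h2
    simp [h1, h2]
  smul_mem' := by
    rintro c h ⟨a, haF, ha⟩
    refine ⟨c • a, F.smul_mem c haF, (Lp.coeFn_smul c a).trans ?_⟩
    filter_upwards [ha] with ω h1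
    simp [h1]

theorem isSquareIntegrableClass_pullbackClass (Φ : M → EuclideanSpace ℝ (Fin L))
    (F : Submodule 𝕜 (Lp (EuclideanSpace 𝕜 (Fin d)) 2 μ)) :
    IsSquareIntegrableClass μ Φ (pullbackClass Φ F) := by
  rintro h ⟨ψ, _, hψ⟩
  exact (memLp_congr_ae hψ).1 (Lp.memLp ψ)

/-- Every space of square integrable functions is realized through an almost everywhere injective
map. -/
theorem hypSubspace_pullbackClass {Φ : M → EuclideanSpace ℝ (Fin L)} {s : Set M}
    (hΦ : Set.InjOn Φ s) (hs : s ∈ ae μ) (F : Submodule 𝕜 (Lp (EuclideanSpace 𝕜 (Fin d)) 2 μ)) :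
    hypSubspace μ Φ (pullbackClass Φ F) = F := by
  ext ψ
  constructor
  · rintro ⟨h, ⟨χ, hχF, hχ⟩, hψ⟩
    rwa [Lp.ext (hψ.trans hχ.symm)]
  · intro hψ
    rcases isEmpty_or_nonempty M with hM | hM
    · exact ⟨0, Submodule.zero_mem _, Eventually.of_forall fun ω => hM.elim ω⟩
    have h : ψ =ᵐ[μ] fun ω => ψ (Function.invFunOn Φ s (Φ ω)) := by
      filter_upwards [hs] with ω hω
      rw [hΦ.leftInvOn_invFunOn hω]
    -- Composing with a left inverse of `Φ` on `s` suffices, since the functions on `ℝ^L` need not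
    -- be measurable.
    exact ⟨fun y => ψ (Function.invFunOn Φ s y), ⟨ψ, hψ, h⟩, h⟩

theorem isHypothesisSpace_pullbackClass [IsFiniteMeasure μ] {Φ : M → EuclideanSpace ℝ (Fin L)}
    {s : Set M} (hΦ : Set.InjOn Φ s) (hs : s ∈ ae μ)
    {F : Submodule 𝕜 (Lp (EuclideanSpace 𝕜 (Fin d)) 2 μ)} (hF : FiniteDimensional 𝕜 F)
    (hc : constSubspace μ 𝕜 (EuclideanSpace 𝕜 (Fin d)) ≤ F) :
    IsHypothesisSpace μ Φ (pullbackClass Φ F) where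
  memLp := isSquareIntegrableClass_pullbackClass Φ F
  finiteDimensional := by rwa [hypSubspace_pullbackClass hΦ hs]
  const_mem c := by
    rw [hypSubspace_pullbackClass hΦ hs]
    exact hc ⟨c, rfl⟩

theorem toLp_mem_hypSubspace {Φ : M → EuclideanSpace ℝ (Fin L)}
    {H : Submodule 𝕜 (EuclideanSpace ℝ (Fin L) → EuclideanSpace 𝕜 (Fin d))}
    {h : EuclideanSpace ℝ (Fin L) → EuclideanSpace 𝕜 (Fin d)} (hh : h ∈ H)
    (hL : MemLp (fun ω => h (Φ ω)) 2 μ) : hL.toLp ∈ hypSubspace μ Φ H :=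
  ⟨h, hh, hL.coeFn_toLp⟩

theorem eLpNorm_sub_eq {u : Lp (EuclideanSpace 𝕜 (Fin d)) 2 μ} {v h : M → EuclideanSpace 𝕜 (Fin d)}
    (hv : u =ᵐ[μ] v) {y : Lp (EuclideanSpace 𝕜 (Fin d)) 2 μ} (hy : y =ᵐ[μ] h) :
    eLpNorm (fun ω => v ω - h ω) 2 μ = ENNReal.ofReal ‖u - y‖ := by
  rw [Lp.norm_def, ENNReal.ofReal_toReal (Lp.eLpNorm_ne_top _)]
  refine eLpNorm_congr_ae ?_
  filter_upwards [Lp.coeFn_sub u y, hv, hy] with ω h1 h2 h3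
  rw [h1, Pi.sub_apply, h2, h3]

/-- The distance of a closest approximation is the distance to the projection. -/
theorem IsClosestApprox.norm_sub_toLp_eq {Φ : M → EuclideanSpace ℝ (Fin L)}
    {H : Submodule 𝕜 (EuclideanSpace ℝ (Fin L) → EuclideanSpace 𝕜 (Fin d))}
    {w : EuclideanSpace ℝ (Fin L) → EuclideanSpace ℝ (Fin d)}
    {wHat : EuclideanSpace ℝ (Fin L) → EuclideanSpace 𝕜 (Fin d)}
    (hH : IsSquareIntegrableClass μ Φ H) (hw : IsClosestApprox μ Φ H w wHat)
    {u : Lp (EuclideanSpace 𝕜 (Fin d)) 2 μ} (hu : u =ᵐ[μ] fun ω => ofRealVec 𝕜 (w (Φ ω))) :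
    ‖u - (hH wHat hw.1).toLp‖ = ‖u - hypProj μ Φ H u‖ := by
  have hmem := toLp_mem_hypSubspace hw.1 (hH wHat hw.1)
  have hmin : ∀ y : hypSubspace μ Φ H, ‖u - (hH wHat hw.1).toLp‖ ≤ ‖u - y‖ := by
    rintro ⟨y, h, hh, hy⟩
    have := hw.2 h hh
    rw [eLpNorm_sub_eq hu (hH wHat hw.1).coeFn_toLp, eLpNorm_sub_eq hu hy] at this
    exact (ENNReal.ofReal_le_ofReal_iff (norm_nonneg _)).1 this
  have hinf : ‖u - (hH wHat hw.1).toLp‖ = ⨅ y : hypSubspace μ Φ H, ‖u - y‖ :=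
    le_antisymm (le_ciInf hmin) (ciInf_le
      ⟨0, by rintro _ ⟨z, rfl⟩; exact norm_nonneg _⟩ (⟨_, hmem⟩ : hypSubspace μ Φ H))
  -- A minimizer over a subspace has orthogonal residual even when the subspace is not closed, and
  -- orthogonality passes to the closure.
  have horth : u - (hH wHat hw.1).toLp ∈ (hypSubspace μ Φ H)ᗮ :=
    (Submodule.mem_orthogonal' _ _).2
      (((hypSubspace μ Φ H).norm_eq_iInf_iff_inner_eq_zero hmem).1 hinf)
  rw [← Submodule.orthogonal_closure] at horth
  rw [hypProj, Submodule.eq_starProjection_of_mem_orthogonal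
    (Submodule.le_topologicalClosure _ hmem) horth]

theorem exists_isClosestApprox {Φ : M → EuclideanSpace ℝ (Fin L)}
    {H : Submodule 𝕜 (EuclideanSpace ℝ (Fin L) → EuclideanSpace 𝕜 (Fin d))}
    (hH : IsSquareIntegrableClass μ Φ H) [FiniteDimensional 𝕜 (hypSubspace μ Φ H)]
    {w : EuclideanSpace ℝ (Fin L) → EuclideanSpace ℝ (Fin d)}
    {u : Lp (EuclideanSpace 𝕜 (Fin d)) 2 μ} (hu : u =ᵐ[μ] fun ω => ofRealVec 𝕜 (w (Φ ω))) :
    ∃ wHat, IsClosestApprox μ Φ H w wHat := by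
  obtain ⟨h, hh, hy⟩ := (hypSubspace μ Φ H).starProjection_apply_mem u
  refine ⟨h, hh, fun k hk => ?_⟩
  rw [eLpNorm_sub_eq hu hy, eLpNorm_sub_eq hu (hH k hk).coeFn_toLp]
  exact ENNReal.ofReal_le_ofReal
    (Submodule.norm_sub_starProjection_le _ _ (toLp_mem_hypSubspace hk (hH k hk)))

theorem hypProj_eq_starProjection {Φ : M → EuclideanSpace ℝ (Fin L)}
    {H : Submodule 𝕜 (EuclideanSpace ℝ (Fin L) → EuclideanSpace 𝕜 (Fin d))}
    [FiniteDimensional 𝕜 (hypSubspace μ Φ H)] :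
    hypProj μ Φ H = (hypSubspace μ Φ H).starProjection := by
  rw [hypProj]
  congr!
  exact (hypSubspace μ Φ H).closed_of_finiteDimensional.submodule_topologicalClosure_eq

end Hypothesis

section Observable

variable {M : Type*} [TopologicalSpace M] [SecondCountableTopology M] [MeasurableSpace M]
  [BorelSpace M] {μ : Measure M} [IsProbabilityMeasure μ] {d : ℕ} {f : M → M}

theorem koopmanIsometry_iterate_obsL2 (𝕜 : Type*) [RCLike 𝕜] (hf : MeasurePreserving f μ μ)
    (hμ : IsCompact μ.support) {φ : M → EuclideanSpace ℝ (Fin d)} (hφ : Continuous φ) (n : ℕ) :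
    (koopmanIsometry 𝕜 (EuclideanSpace 𝕜 (Fin d)) hf)^[n] (obsL2 𝕜 hμ hφ) =ᵐ[μ]
      fun ω => ofRealVec 𝕜 (φ (f^[n] ω)) := by
  rw [obsL2, koopmanIsometry_iterate_toLp]
  exact MemLp.coeFn_toLp _

end Observable

section WeakLimit

variable {M : Type*} [MeasurableSpace M] {μ : Measure M} [IsProbabilityMeasure μ] {d : ℕ}
  {f : M → M}

/-- The component of a function orthogonal to the compact part has weakly vanishing iterates
along a set of times of density one, and along all times for a strongly mixing map. -/
theorem exists_hasDensityOne_tendsto_inner_koopman (𝕜 : Type*) [RCLike 𝕜]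
    (hf : MeasurePreserving f μ μ) (u : Lp (EuclideanSpace 𝕜 (Fin d)) 2 μ) :
    ∃ A : Set ℕ, HasDensityOne A ∧ (IsStronglyMixing μ f → A = Set.univ) ∧
      ∀ x, Tendsto (fun n => inner 𝕜 ((koopmanIsometry 𝕜 (EuclideanSpace 𝕜 (Fin d)) hf)^[n]
        (u - (compactSubspace (koopmanIsometry 𝕜 (EuclideanSpace 𝕜 (Fin d)) hf)).starProjection
          u)) x) (atTop ⊓ 𝓟 A) (𝓝 0) := by
  set U := koopmanIsometry 𝕜 (EuclideanSpace 𝕜 (Fin d)) hf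
  have horth : u - (compactSubspace U).starProjection u ∈ (compactSubspace U)ᗮ :=
    Submodule.sub_starProjection_mem_orthogonal _
  -- The case split lets a single set of times serve all claims, including the one that it is `ℕ`
  -- under strong mixing.
  by_cases hmix : IsStronglyMixing μ f
  · refine ⟨Set.univ, hasDensityOne_univ, fun _ => rfl, fun x => ?_⟩
    rw [principal_univ, inf_top_eq]
    refine hmix.tendsto_inner hf (Submodule.orthogonal_le ?_ horth) x
    exact fun y hy => Submodule.le_topologicalClosure _
      (mem_finInvariantSpan.2 ⟨_, isFinInvariant_constSubspace hf, hy⟩)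
  · obtain ⟨A, hA, h⟩ := exists_hasDensityOne_tendsto_inner U horth
    exact ⟨A, hA, fun h' => absurd h' hmix, h⟩

end WeakLimit

end DirectForecast

/-! ### The main theorem. -/

theorem theorem5p1 {m d L : ℕ} {M : Type*} [TopologicalSpace M] [T2Space M]
    [SecondCountableTopology M] [ChartedSpace (EuclideanSpace ℝ (Fin m)) M]
    [IsManifold (𝓡 m) 1 M] [MeasurableSpace M] [BorelSpace M]
    -- the dynamical system and its ergodic measure with compact support
    (f : M → M) (hf : ContMDiff (𝓡 m) (𝓡 m) 1 f)
    (μ : Measure M) [IsProbabilityMeasure μ] (hμ : Ergodic f μ) (hΩ : IsCompact μ.support)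
    -- the measurement
    (φ : M → EuclideanSpace ℝ (Fin d)) (hφ : ContMDiff (𝓡 m) (𝓡 d) 1 φ)
    -- the embedding of the support, and the embedding mechanism
    (Φ : M → EuclideanSpace ℝ (Fin L)) (hΦ : Set.InjOn Φ μ.support)
    (g : EuclideanSpace ℝ (Fin d) × EuclideanSpace ℝ (Fin L) → EuclideanSpace ℝ (Fin L))
    (hg : ∀ ω ∈ μ.support, Φ (f ω) = g (φ ω, Φ ω))
    -- the feedback functions
    (w : ℕ → EuclideanSpace ℝ (Fin L) → EuclideanSpace ℝ (Fin d))
    (hw : ∀ k : ℕ, ∀ ω ∈ μ.support, w k (Φ ω) = φ (f^[k] ω))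
    -- the scalars of the hypothesis spaces, real or complex
    (𝕜 : Type*) [RCLike 𝕜] :
    -- the formula for the error, for an arbitrary linear space of functions
    (∀ H : Submodule 𝕜 (EuclideanSpace ℝ (Fin L) → EuclideanSpace 𝕜 (Fin d)),
      IsSquareIntegrableClass μ Φ H →
      ∀ (n : ℕ) (wHat : EuclideanSpace ℝ (Fin L) → EuclideanSpace 𝕜 (Fin d)),
        IsClosestApprox μ Φ H (w n) wHat →
        directError μ f φ Φ wHat n =
          ‖((koopman 𝕜 (EuclideanSpace 𝕜 (Fin d)) hμ.toMeasurePreserving) ^ n)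
                (obsL2 𝕜 hΩ hφ.continuous) -
            hypProj μ Φ H
              (((koopman 𝕜 (EuclideanSpace 𝕜 (Fin d)) hμ.toMeasurePreserving) ^ n)
                (obsL2 𝕜 hΩ hφ.continuous))‖) ∧
    -- closest approximations exist in hypothesis spaces
    (∀ H : Submodule 𝕜 (EuclideanSpace ℝ (Fin L) → EuclideanSpace 𝕜 (Fin d)),
      IsHypothesisSpace μ Φ H →
      ∀ n : ℕ, ∃ wHat, IsClosestApprox μ Φ H (w n) wHat) ∧
    ∃ N' : Set ℕ, HasDensityOne N' ∧
      -- (i) for every hypothesis space, no limit point is below the distance of `φ` to `𝒟`; for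
      -- every large enough one, all limit points are within `ε` of it; and the limit exists for
      -- some such choice
      (∀ H : Submodule 𝕜 (EuclideanSpace ℝ (Fin L) → EuclideanSpace 𝕜 (Fin d)),
        IsHypothesisSpace μ Φ H →
        ∀ wHat : ℕ → EuclideanSpace ℝ (Fin L) → EuclideanSpace 𝕜 (Fin d),
          (∀ n, IsClosestApprox μ Φ H (w n) (wHat n)) →
          ∀ η : ℝ, 0 < η → ∀ᶠ n in atTop ⊓ 𝓟 N',
            mixingResidual hΩ hφ.continuous hμ.toMeasurePreserving - η <
              directError μ f φ Φ (wHat n) n) ∧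
      (∀ ε : ℝ, 0 < ε → ∃ H₀ : Submodule 𝕜 (EuclideanSpace ℝ (Fin L) → EuclideanSpace 𝕜 (Fin d)),
        IsHypothesisSpace μ Φ H₀ ∧
        (∃ l : ℝ,
          mixingResidual hΩ hφ.continuous hμ.toMeasurePreserving ≤ l ∧
          l < mixingResidual hΩ hφ.continuous hμ.toMeasurePreserving + ε ∧
          ∀ wHat : ℕ → EuclideanSpace ℝ (Fin L) → EuclideanSpace 𝕜 (Fin d),
            (∀ n, IsClosestApprox μ Φ H₀ (w n) (wHat n)) →
            Tendsto (fun n => directError μ f φ Φ (wHat n) n)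
              (atTop ⊓ 𝓟 N') (𝓝 l)) ∧
        ∀ H : Submodule 𝕜 (EuclideanSpace ℝ (Fin L) → EuclideanSpace 𝕜 (Fin d)),
          IsHypothesisSpace μ Φ H →
          hypSubspace μ Φ H₀ ≤ hypSubspace μ Φ H →
          ∀ wHat : ℕ → EuclideanSpace ℝ (Fin L) → EuclideanSpace 𝕜 (Fin d),
            (∀ n, IsClosestApprox μ Φ H (w n) (wHat n)) →
            ∀ᶠ n in atTop ⊓ 𝓟 N',
              directError μ f φ Φ (wHat n) n <
                mixingResidual hΩ hφ.continuous hμ.toMeasurePreserving + ε) ∧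
      -- (ii) weak mixing
      (IsWeaklyMixing hμ.toMeasurePreserving →
        ∀ H : Submodule 𝕜 (EuclideanSpace ℝ (Fin L) → EuclideanSpace 𝕜 (Fin d)),
          IsHypothesisSpace μ Φ H →
          ∀ wHat : ℕ → EuclideanSpace ℝ (Fin L) → EuclideanSpace 𝕜 (Fin d),
            (∀ n, IsClosestApprox μ Φ H (w n) (wHat n)) →
            Tendsto (fun n => directError μ f φ Φ (wHat n) n)
              (atTop ⊓ 𝓟 N') (𝓝 (stdDev μ φ))) ∧
      -- (iii) strong mixing: the whole of `ℕ`
      (IsStronglyMixing μ f → N' = Set.univ ∧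
        ∀ H : Submodule 𝕜 (EuclideanSpace ℝ (Fin L) → EuclideanSpace 𝕜 (Fin d)),
          IsHypothesisSpace μ Φ H →
          ∀ wHat : ℕ → EuclideanSpace ℝ (Fin L) → EuclideanSpace 𝕜 (Fin d),
            (∀ n, IsClosestApprox μ Φ H (w n) (wHat n)) →
            Tendsto (fun n => directError μ f φ Φ (wHat n) n)
              atTop (𝓝 (stdDev μ φ))) ∧
      -- (iv) purely discrete spectrum
      (HasPurelyDiscreteSpectrum hμ.toMeasurePreserving →
        ∀ ε : ℝ, 0 < ε → ∃ H₀ : Submodule 𝕜 (EuclideanSpace ℝ (Fin L) → EuclideanSpace 𝕜 (Fin d)),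
          IsHypothesisSpace μ Φ H₀ ∧
          ∀ H : Submodule 𝕜 (EuclideanSpace ℝ (Fin L) → EuclideanSpace 𝕜 (Fin d)),
            IsHypothesisSpace μ Φ H →
            hypSubspace μ Φ H₀ ≤ hypSubspace μ Φ H →
            ∀ wHat : ℕ → EuclideanSpace ℝ (Fin L) → EuclideanSpace 𝕜 (Fin d),
              (∀ n, IsClosestApprox μ Φ H (w n) (wHat n)) →
              ∀ n : ℕ, directError μ f φ Φ (wHat n) n < ε) := by

  set hmp : MeasurePreserving f μ μ := hμ.toMeasurePreserving
  set U := koopmanIsometry 𝕜 (EuclideanSpace 𝕜 (Fin d)) hmp with hU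
  set u := obsL2 𝕜 hΩ hφ.continuous with hu
  have hsupp : μ.support ∈ ae μ := Measure.support_mem_ae
  have hiter : ∀ n, U^[n] u =ᵐ[μ] fun ω => ofRealVec 𝕜 (φ (f^[n] ω)) :=
    koopmanIsometry_iterate_obsL2 𝕜 hmp hΩ hφ.continuous
  have hiterw : ∀ n, U^[n] u =ᵐ[μ] fun ω => ofRealVec 𝕜 (w n (Φ ω)) := fun n => by
    filter_upwards [hiter n, hsupp] with ω h1 h2
    rw [h1, hw n ω h2]
  have herr : ∀ H : Submodule 𝕜 (EuclideanSpace ℝ (Fin L) → EuclideanSpace 𝕜 (Fin d)),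
      IsSquareIntegrableClass μ Φ H →
      ∀ (n : ℕ) (wHat : EuclideanSpace ℝ (Fin L) → EuclideanSpace 𝕜 (Fin d)),
        IsClosestApprox μ Φ H (w n) wHat →
        directError μ f φ Φ wHat n = ‖U^[n] u - hypProj μ Φ H (U^[n] u)‖ := by
    intro H hH n wHat hwHat
    rw [directError, eLpNorm_sub_eq (hiter n) (hH wHat hwHat.1).coeFn_toLp,
      ENNReal.toReal_ofReal (norm_nonneg _)]
    exact hwHat.norm_sub_toLp_eq hH (hiterw n)
  have herr' : ∀ H : Submodule 𝕜 (EuclideanSpace ℝ (Fin L) → EuclideanSpace 𝕜 (Fin d)),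
      ∀ hH : IsHypothesisSpace μ Φ H, have := hH.finiteDimensional;
      ∀ (n : ℕ) (wHat : EuclideanSpace ℝ (Fin L) → EuclideanSpace 𝕜 (Fin d)),
        IsClosestApprox μ Φ H (w n) wHat →
        directError μ f φ Φ wHat n =
          ‖U^[n] u - (hypSubspace μ Φ H).starProjection (U^[n] u)‖ := by
    intro H hH this n wHat hwHat
    rw [herr H hH.memLp n wHat hwHat, hypProj_eq_starProjection]
  have hres : mixingResidual hΩ hφ.continuous hmp = compactResidual U u :=
    mixingResidual_eq_compactResidual 𝕜 hΩ hφ.continuous hmp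
  -- `U^n ψ` stays in `F` and competes at time `n`, at distance `‖u - ψ‖` by isometry.
  have hupper : ∀ (F : Submodule 𝕜 (Lp (EuclideanSpace 𝕜 (Fin d)) 2 μ)), IsFinInvariant U F →
      ∀ ψ ∈ F, ∀ H : Submodule 𝕜 (EuclideanSpace ℝ (Fin L) → EuclideanSpace 𝕜 (Fin d)),
      IsHypothesisSpace μ Φ H → F ≤ hypSubspace μ Φ H →
      ∀ (n : ℕ) (wHat : EuclideanSpace ℝ (Fin L) → EuclideanSpace 𝕜 (Fin d)),
        IsClosestApprox μ Φ H (w n) wHat → directError μ f φ Φ wHat n ≤ ‖u - ψ‖ := by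
    intro F hF ψ hψ H hH hle n wHat hwHat
    have := hH.finiteDimensional
    have hmem : ∀ k, U^[k] ψ ∈ F := fun k => by
      induction k with
      | zero => exact hψ
      | succ k ih =>
        rw [Function.iterate_succ_apply']
        exact hF.2 _ ih
    rw [herr' H hH n wHat hwHat]
    refine (Submodule.norm_sub_starProjection_le _ _ (hle (hmem n))).trans_eq ?_
    rw [← iterate_map_sub, norm_iterate]
  have hC : IsFinInvariant U (constSubspace μ 𝕜 (EuclideanSpace 𝕜 (Fin d))) :=
    isFinInvariant_constSubspace hmp
  have hCle : ∀ H : Submodule 𝕜 (EuclideanSpace ℝ (Fin L) → EuclideanSpace 𝕜 (Fin d)),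
      IsHypothesisSpace μ Φ H →
      constSubspace μ 𝕜 (EuclideanSpace 𝕜 (Fin d)) ≤ hypSubspace μ Φ H := by
    rintro H hH _ ⟨c, rfl⟩
    exact hH.const_mem c
  -- The set depends on `u` and `U` only, and is fixed before any hypothesis space.
  obtain ⟨N', hN', huniv, hweak⟩ := exists_hasDensityOne_tendsto_inner_koopman 𝕜 hmp u
  have hlower : ∀ H : Submodule 𝕜 (EuclideanSpace ℝ (Fin L) → EuclideanSpace 𝕜 (Fin d)),
      IsHypothesisSpace μ Φ H →
      ∀ wHat : ℕ → EuclideanSpace ℝ (Fin L) → EuclideanSpace 𝕜 (Fin d),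
        (∀ n, IsClosestApprox μ Φ H (w n) (wHat n)) →
        ∀ η : ℝ, 0 < η → ∀ᶠ n in atTop ⊓ 𝓟 N',
          mixingResidual hΩ hφ.continuous hmp - η < directError μ f φ Φ (wHat n) n := by
    intro H hH wHat hwHat η hη
    have := hH.finiteDimensional
    rw [hres]
    have horth : inner 𝕜 (u - (u - (compactSubspace U).starProjection u))
        (u - (compactSubspace U).starProjection u) = 0 := by
      rw [sub_sub_cancel]
      exact (Submodule.mem_orthogonal _ _).1
        (Submodule.sub_starProjection_mem_orthogonal u) _ (Submodule.starProjection_apply_mem _ u)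
    filter_upwards [eventually_lt_norm_sub_starProjection U horth hweak (hypSubspace μ Φ H) hη]
      with n hn
    rw [herr' H hH n (wHat n) (hwHat n)]
    exact hn
  have hlarge : ∀ ε : ℝ, 0 < ε → ∃ F : Submodule 𝕜 (Lp (EuclideanSpace 𝕜 (Fin d)) 2 μ),
      IsFinInvariant U F ∧ constSubspace μ 𝕜 (EuclideanSpace 𝕜 (Fin d)) ≤ F ∧
      ∃ ψ ∈ F, ‖u - ψ‖ < mixingResidual hΩ hφ.continuous hmp + ε := by
    intro ε hε
    obtain ⟨F, hF, ψ, hψ, hlt⟩ := exists_norm_sub_lt U u hε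
    exact ⟨F ⊔ constSubspace μ 𝕜 _, hF.sup hC, le_sup_right, ψ, Submodule.mem_sup_left hψ,
      hres ▸ hlt⟩
  -- The lower bound is `hlower`, the residual being the standard deviation; the upper one is
  -- `hupper` with `F` the constants and `ψ` the mean.
  have hstd : IsWeaklyMixing hmp →
      ∀ H : Submodule 𝕜 (EuclideanSpace ℝ (Fin L) → EuclideanSpace 𝕜 (Fin d)),
        IsHypothesisSpace μ Φ H →
        ∀ wHat : ℕ → EuclideanSpace ℝ (Fin L) → EuclideanSpace 𝕜 (Fin d),
          (∀ n, IsClosestApprox μ Φ H (w n) (wHat n)) →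
          Tendsto (fun n => directError μ f φ Φ (wHat n) n) (atTop ⊓ 𝓟 N') (𝓝 (stdDev μ φ)) := by
    intro hwm H hH wHat hwHat
    refine tendsto_order.2 ⟨fun a ha => ?_, fun a ha => Eventually.of_forall fun n => ?_⟩
    · filter_upwards [hlower H hH wHat hwHat _ (sub_pos.2 ha)] with n hn
      rw [hwm.mixingResidual_eq_stdDev] at hn
      linarith
    · refine lt_of_le_of_lt ?_ ha
      rw [← norm_obsL2_sub_const 𝕜 hΩ hφ.continuous]
      exact hupper _ hC _ (const_mem_constSubspace _) H hH (hCle H hH) n (wHat n) (hwHat n)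
  refine ⟨fun H hH n wHat hwHat => ?_, fun H hH n => ?_, N', hN', hlower, fun ε hε => ?_, hstd,
    fun hmix => ⟨huniv hmix, ?_⟩, fun hdisc ε hε => ?_⟩
  · rw [koopman_pow_apply]
    exact herr H hH n wHat hwHat
  · have := hH.finiteDimensional
    exact exists_isClosestApprox hH.memLp (hiterw n)
  · obtain ⟨F, hF, hCF, ψ, hψ, hlt⟩ := hlarge ε hε
    have := hF.1
    have hH₀ := isHypothesisSpace_pullbackClass hΦ hsupp hF.1 hCF
    have hF₀ := hypSubspace_pullbackClass hΦ hsupp F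
    -- For `𝒲 = F` invariant the projection commutes with `U`, so the error does not depend on `n`;
    -- its value is the limit `l`.
    refine ⟨pullbackClass Φ F, hH₀, ⟨‖u - F.starProjection u‖, ?_, ?_, fun wHat hwHat => ?_⟩,
      fun H hH hle wHat hwHat => Eventually.of_forall fun n => ?_⟩
    · rw [hres]
      exact compactResidual_le _ hF (F.starProjection_apply_mem u)
    · exact (Submodule.norm_sub_starProjection_le _ _ hψ).trans_lt hlt
    · refine tendsto_const_nhds.congr fun n => ?_
      rw [herr' _ hH₀ n _ (hwHat n), ← hF.norm_iterate_sub_starProjection u n]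
      congr!
      exact hF₀.symm
    · rw [hF₀] at hle
      exact (hupper F hF ψ hψ H hH hle n _ (hwHat n)).trans_lt hlt
  · have h := hstd (hmix.isWeaklyMixing hmp)
    rwa [huniv hmix, principal_univ, inf_top_eq] at h
  · obtain ⟨F, hF, hCF, ψ, hψ, hlt⟩ := hlarge ε hε
    rw [hdisc.mixingResidual_eq_zero, zero_add] at hlt
    refine ⟨pullbackClass Φ F, isHypothesisSpace_pullbackClass hΦ hsupp hF.1 hCF,
      fun H hH hle wHat hwHat n => ?_⟩
    rw [hypSubspace_pullbackClass hΦ hsupp] at hle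
    exact (hupper F hF ψ hψ H hH hle n _ (hwHat n)).trans_lt hlt
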